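/- Let $J$ be a nonempty finite totally ordered set of tasks with processing times $p\in(\mathbb R_{>0})^J$, a common due date $d\ge 0$, and unit earliness and tardiness penalties $\alpha\in(\mathbb R_{\ge 0})^J$, $\beta\in(\mathbb R_{>0})^J$. Write $p(S)=\sum_{j\in S}p_j$ for $S\subseteq J$. **Schedules.** A feasible schedule is a vector $C\in\mathbb R^J$ of completion times with $C_j\ge p_j$ for all $j$ and, for all $i\ne j$, $C_j\ge C_i+p_j$ or $C_i\ge C_j+p_i$. It is a block if it has no idle time between its first start and its last completion, and a $d$-or-left-block if it is a block in which some task completes exactly at $d$ or some task starts at time $0$ (or both). A schedule is optimal if it minimizes $f_{\alpha,\beta}(C)=\sum_{j}\alpha_j[d-C_j]^++\beta_j[C_j-d]^+$ over all feasible schedules. **Formulation (F3).** Let $J^<=\{(i,j)\in J^2: i<j\}$ and $S^<=J^<\cap S^2$. Let $P^3$ be the polyhedron of all $X=(e',t',\delta,x,a,b,\gamma)\in\mathbb R^J\times\mathbb R^J\times[0,1]^J\times\mathbb R^{J^<}\times\mathbb R\times\mathbb R^J\times[0,1]^J$ such that - for all $j\in J$: $0\le e'_j\le\delta_j(p(J)-p_j)$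 and $0\le t'_j\le(1-\delta_j)\,p(J)$; - for all $(i,j)\in J^<$: $x_{i,j}\ge\delta_i-\delta_j$, $x_{i,j}\ge\delta_j-\delta_i$, $x_{i,j}\le\delta_i+\delta_j$, $x_{i,j}\le 2-(\delta_i+\delta_j)$; - $a\ge 0$, $\sum_{j}p_j\delta_j\le d-a$, and for all $j\in J$: $e'_j+p_j\delta_j\le d-a$ and $a\le p_j+(1-\gamma_j)d$; - $\sum_j\gamma_j=1$, and for all $j\in J$: $\delta_j\le 1-\gamma_j$ and $t'_j\le p_j+(1-\gamma_j)(p(J)-p_j)$; - for all $j\in J$: $b_j\ge 0$, $b_j\le a$, $b_j\le\delta_j d$, $b_j\ge a-(1-\delta_j)d$; - for all $S\subseteq J$: $\sum_{i\in S}p_ie'_i\ge\sum_{(i,j)\in S^<}p_ip_j\frac{\delta_i+\delta_j-x_{i,j}}2$ and $\sum_{i\in S}p_it'_i\ge\sum_{(i,j)\in S^<}p_ip_j\frac{2-(\delta_i+\delta_j)-x_{i,j}}2+\sum_{i\in S}p_i^2(1-\delta_i)$. Let $\mathrm{int}_{\delta,\gamma}(\mathrm{extr}\,P^3)$ be the set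 of extreme points of $P^3$ with $\delta,\gamma\in\{0,1\}^J$, and let $$h_{\alpha,\beta}(X)=\sum_{j\in J}\big(\alpha_je'_j+\beta_jt'_j+(\alpha_j+\beta_j)b_j-\beta_ja\big).$$ **Encoding.** For $C\in\mathbb R^J$ and $\emptyset\neq T\subseteq J$ put $a=d-\min_{i\in T}(C_i-p_i)$ and $\theta_T(C)=\big(([d-a-C_j]^+)_j,\,([C_j-(d-a)]^+)_j,\,a,\,a\mathbf 1_{J\setminus T}\big)$. The vector $X$ encodes $C$ if $(e',t',a,b)=\theta_T(C)$ for $T=\{j: C_j>d\}$ or for $T=\{j: C_j\ge d\}$, with $T$ nonempty. **Theorem.** 1. If $d\le p(J)$ or $\alpha\neq 0$, then every optimal $d$-or-left-block is encoded by a vector minimizing $h_{\alpha,\beta}$ on $\mathrm{int}_{\delta,\gamma}(\mathrm{extr}\,P^3)$. 2. If $\alpha_j>0$ for all $j\in J$, then every vector minimizing $h_{\alpha,\beta}$ on $\mathrm{int}_{\delta,\gamma}(\mathrm{extr}\,P^3)$ encodes an optimal $d$-or-left-block. 3. In general (some $\alpha_j$ possibly zero), for every vector $X$ minimizing $h_{\alpha,\beta}$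 on $\mathrm{int}_{\delta,\gamma}(\mathrm{extr}\,P^3)$ there is an optimal schedule $C$ with $C_j=d-a-e'_j+t'_j$ for every task $j$, except that the tasks with $\delta_j=1$ and $\alpha_j=0$ are only required to satisfy $C_j\le d-a$. -/

import Mathlib

open scoped BigOperators

/-!  Single-machine scheduling with a common due date `d`.  The finite linearly ordered type `J` is
the set of tasks, `p j` the processing time of `j`, and `alpha j`, `beta j` its unit earliness and
tardiness penalties.  A schedule is given by its completion times `C : J → ℝ`, so that task `j` is
processed from `C j - p j` to `C j`. -/

namespace CommonDueDate

section Schedules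

variable {J : Type*} [Fintype J]

/-- Feasible schedules: no task starts before time `0`, and distinct tasks do not overlap. -/
def Feasible (p C : J → ℝ) : Prop :=
  (∀ j, p j ≤ C j) ∧ ∀ i j, i ≠ j → C i + p j ≤ C j ∨ C j + p i ≤ C i

/-- No idle time: whenever some task has already started and some task is not yet completed,
a task is being processed. -/
def NoIdle (p C : J → ℝ) : Prop :=
  ∀ s : ℝ, (∃ i, C i - p i ≤ s) → (∃ k, s < C k) → ∃ j, C j - p j ≤ s ∧ s < C j

/-- A block is a feasible schedule without idle time. -/
def IsBlock (p C : J → ℝ) : Prop := Feasible p C ∧ NoIdle p C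

/-- A `d`-or-left-block is a block that holds an on-time task (one completing exactly at `d`) or
starts at time `0`, or both. -/
def IsDOrLeftBlock (p : J → ℝ) (d : ℝ) (C : J → ℝ) : Prop :=
  IsBlock p C ∧ ((∃ j, C j = d) ∨ ∃ j, C j - p j = 0)

/-- The total earliness-tardiness penalty of a schedule. -/
noncomputable def penalty (alpha beta : J → ℝ) (d : ℝ) (C : J → ℝ) : ℝ :=
  ∑ j, (alpha j * max (d - C j) 0 + beta j * max (C j - d) 0)

/-- Optimal schedules: feasible, with minimum total penalty among all feasible schedules. -/
def IsOptimal (p alpha beta : J → ℝ) (d : ℝ) (C : J → ℝ) : Prop :=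
  Feasible p C ∧ ∀ C', Feasible p C' → penalty alpha beta d C ≤ penalty alpha beta d C'

end Schedules

section Formulation

/-- The pairs `(i, j)` of tasks with `i < j`. -/
abbrev Pairs (J : Type*) [LinearOrder J] : Type _ := {q : J × J // q.1 < q.2}

/-- The ambient real vector space of the vectors `(e', t', δ, x, a, b, γ)`. -/
abbrev Point (J : Type*) [LinearOrder J] : Type _ :=
  (J → ℝ) × (J → ℝ) × (J → ℝ) × (Pairs J → ℝ) × ℝ × (J → ℝ) × (J → ℝ)

variable {J : Type*} [LinearOrder J]

/-- The component `e'`. -/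
def early (X : Point J) : J → ℝ := X.1
/-- The component `t'`. -/
def tardy (X : Point J) : J → ℝ := X.2.1
/-- The component `δ`. -/
def delta (X : Point J) : J → ℝ := X.2.2.1
/-- The component `x`. -/
def cross (X : Point J) : Pairs J → ℝ := X.2.2.2.1
/-- The component `a`. -/
def shift (X : Point J) : ℝ := X.2.2.2.2.1
/-- The component `b`. -/
def prodv (X : Point J) : J → ℝ := X.2.2.2.2.2.1
/-- The component `γ`. -/
def gam (X : Point J) : J → ℝ := X.2.2.2.2.2.2

variable [Fintype J]

/-- The pairs `i < j` with both tasks in `S`. -/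
def pairsIn (S : Finset J) : Finset (Pairs J) :=
  Finset.univ.filter fun q => q.1.1 ∈ S ∧ q.1.2 ∈ S

/-- The linear inequalities defining the polyhedron. -/
structure InP3 (p : J → ℝ) (d : ℝ) (X : Point J) : Prop where
  delta_nonneg : ∀ j, 0 ≤ delta X j
  delta_le_one : ∀ j, delta X j ≤ 1
  gam_nonneg : ∀ j, 0 ≤ gam X j
  gam_le_one : ∀ j, gam X j ≤ 1
  -- consistency of `e'`, `t'` and `δ`
  early_nonneg : ∀ j, 0 ≤ early X j
  early_le : ∀ j, early X j ≤ delta X j * ((∑ i, p i) - p j)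
  tardy_nonneg : ∀ j, 0 ≤ tardy X j
  tardy_le : ∀ j, tardy X j ≤ (1 - delta X j) * ∑ i, p i
  -- linearization of the products of the `δ` variables
  cross_ge : ∀ q : Pairs J, delta X q.1.1 - delta X q.1.2 ≤ cross X q
  cross_ge' : ∀ q : Pairs J, delta X q.1.2 - delta X q.1.1 ≤ cross X q
  cross_le : ∀ q : Pairs J, cross X q ≤ delta X q.1.1 + delta X q.1.2
  cross_le' : ∀ q : Pairs J, cross X q ≤ 2 - (delta X q.1.1 + delta X q.1.2)
  -- positivity, and the expected value of `a`
  early_add_le : ∀ j, early X j + p j * delta X j ≤ d - shift X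
  sum_delta_le : ∑ j, p j * delta X j ≤ d - shift X
  shift_nonneg : 0 ≤ shift X
  shift_le : ∀ j, shift X ≤ p j + (1 - gam X j) * d
  -- `γ` designates the first task starting at `d - a`
  sum_gam : ∑ j, gam X j = 1
  delta_le_gam : ∀ j, delta X j ≤ 1 - gam X j
  tardy_le_gam : ∀ j, tardy X j ≤ p j + (1 - gam X j) * ((∑ i, p i) - p j)
  -- linearization of the products `b = a * δ`
  prodv_nonneg : ∀ j, 0 ≤ prodv X j
  prodv_le_shift : ∀ j, prodv X j ≤ shift X
  prodv_le : ∀ j, prodv X j ≤ delta X j * d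
  prodv_ge : ∀ j, shift X - (1 - delta X j) * d ≤ prodv X j
  -- non-overlapping of the tasks before, respectively after, `d - a`
  nonoverlap_early : ∀ S : Finset J,
    ∑ q ∈ pairsIn S, p q.1.1 * p q.1.2 * ((delta X q.1.1 + delta X q.1.2 - cross X q) / 2)
      ≤ ∑ i ∈ S, p i * early X i
  nonoverlap_tardy : ∀ S : Finset J,
    ∑ q ∈ pairsIn S,
        p q.1.1 * p q.1.2 * ((2 - (delta X q.1.1 + delta X q.1.2) - cross X q) / 2)
      + ∑ i ∈ S, p i ^ 2 * (1 - delta X i)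
      ≤ ∑ i ∈ S, p i * tardy X i

/-- The polyhedron `P³`. -/
def P3 (p : J → ℝ) (d : ℝ) : Set (Point J) := {X | InP3 p d X}

/-- The points of `V` whose components `δ` and `γ` are `0`-`1` vectors. -/
def intPoints (V : Set (Point J)) : Set (Point J) :=
  {X | X ∈ V ∧ (∀ j, delta X j = 0 ∨ delta X j = 1) ∧ ∀ j, gam X j = 0 ∨ gam X j = 1}

/-- The linear objective function `h_{α,β}`. -/
def objective (alpha beta : J → ℝ) (X : Point J) : ℝ :=
  ∑ j, (alpha j * early X j + beta j * tardy X j + (alpha j + beta j) * prodv X j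
    - beta j * shift X)

/-- `X` minimizes `h_{α,β}` over the `(δ,γ)`-integer extreme points of `P³`. -/
def IsF3Minimizer (p alpha beta : J → ℝ) (d : ℝ) (X : Point J) : Prop :=
  X ∈ intPoints ((P3 p d).extremePoints ℝ) ∧
    IsMinOn (objective alpha beta) (intPoints ((P3 p d).extremePoints ℝ)) X

/-- `(e', t', a, b)` is the vector obtained from the completion times `C` when the tasks of `T` are
regarded as those after the reference point: `d - a` is the least starting time of a task of `T`
(in particular `T` is nonempty), `e'` and `t'` are the earliness and tardiness with respect to
`d - a`, and `b` is `a` times the indicator of the complement of `T`. -/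
def EncodesWith (p : J → ℝ) (d : ℝ) (C : J → ℝ) (T : Set J) (X : Point J) : Prop :=
  IsLeast ((fun i => C i - p i) '' T) (d - shift X) ∧
  (∀ j, early X j = max (d - shift X - C j) 0) ∧
  (∀ j, tardy X j = max (C j - (d - shift X)) 0) ∧
  (∀ j, (j ∈ T → prodv X j = 0) ∧ (j ∉ T → prodv X j = shift X))

/-- The encoding `θ'`, for which `T` is the set of tasks completing after `d`. -/
def EncodesTheta (p : J → ℝ) (d : ℝ) (C : J → ℝ) (X : Point J) : Prop :=
  EncodesWith p d C {j | d < C j} X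

/-- The encoding `θ̃'`, for which `T` is the set of tasks completing at or after `d`. -/
def EncodesThetaTilde (p : J → ℝ) (d : ℝ) (C : J → ℝ) (X : Point J) : Prop :=
  EncodesWith p d C {j | d ≤ C j} X

/-- The vector `X` encodes the schedule `C`. -/
def Encodes (p : J → ℝ) (d : ℝ) (C : J → ℝ) (X : Point J) : Prop :=
  EncodesTheta p d C X ∨ EncodesThetaTilde p d C X

end Formulation

end CommonDueDate

/-! A point of `P3` with binary `δ` and `γ` is determined by the set `T = {j | δ_j = 0}`, the index
`k` with `γ_k = 1`, and a pair `(c, a)`: `c j` is the tardiness of `j ∈ T` with respect to the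
reference point `d - a`, and for `j ∉ T` it is earliness plus processing time, which is a completion
time once time is reflected at `d - a`. In these coordinates both families of nonoverlapping
inequalities are Queyranne's inequalities, the other constraints become bounds on `(c, a)`, and the
objective is affine. Each `(T, k)` thus gives a compact convex slice, and the integer extreme points
of `P3` are exactly the extreme points of the slices.

In a minimizer over a slice, every task of positive weight lies in a tight set, since otherwise its
`c j` could decrease. Tight sets force precedence. If two positive-weight tasks on one side
overlapped, no tight set would separate them, and the direction adding `1 / p i` to one and
subtracting `1 / p j` from the other would remain in the slice both ways, contradicting extremality
(`nonOverlap_of_extreme`). Tasks of zero weight may overlap, but can be rescheduled for free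
(`exists_compressed`). Hence minimizers describe feasible schedules whose penalty is the objective.

Conversely, a feasible schedule costs no less than some slice point: move it right to reach `d` if
necessary, then compress both sides (`exists_inSlice_le_penalty`). So the two minima agree. For the
block statements, extremality in `a` means that `a` is at an end of its range: either a task
completes at `d` or one starts at `0`, up to a degenerate case excluded by optimality. Conversely a
block gives compressed sides, which are extreme in `c`, and the on-time or left condition makes `a`
extreme. -/

namespace CommonDueDate

/-! ### Queyranne's inequalities, tight sets and compressed schedules. -/

section Polymatroid

variable {J : Type*}

/-- The right-hand side of the nonoverlapping inequality of the set `S`. -/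
noncomputable def overlapBound (p : J → ℝ) (S : Finset J) : ℝ :=
  ((∑ i ∈ S, p i) ^ 2 + ∑ i ∈ S, p i ^ 2) / 2

/-- The nonoverlapping inequalities of Queyranne, for all subsets of `A`. -/
def SatisfiesQ (p : J → ℝ) (A : Finset J) (c : J → ℝ) : Prop :=
  ∀ S ⊆ A, overlapBound p S ≤ ∑ i ∈ S, p i * c i

/-- The tasks of `A` with completion times `c` start after time `0` and do not overlap. -/
def NonOverlap (p : J → ℝ) (A : Finset J) (c : J → ℝ) : Prop :=
  (∀ j ∈ A, p j ≤ c j) ∧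
    ∀ i ∈ A, ∀ j ∈ A, i ≠ j → c i + p j ≤ c j ∨ c j + p i ≤ c i

/-- The tasks of `A` are processed one after another from time `0`, in the order of `c`. -/
def IsCompressed (p : J → ℝ) (A : Finset J) (c : J → ℝ) : Prop :=
  ∀ j ∈ A, c j = ∑ i ∈ A with c i ≤ c j, p i

/-- The completion times when the tasks of `A` are processed without idle time from time `0`, in
the order of `c`. -/
noncomputable def compress (p : J → ℝ) (A : Finset J) (c : J → ℝ) (j : J) : ℝ :=
  ∑ i ∈ A with c i ≤ c j, p i

variable {p c : J → ℝ} {A S : Finset J}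

theorem overlapBound_insert [DecidableEq J] {j : J} (hj : j ∉ S) :
    overlapBound p (insert j S) = overlapBound p S + p j * (∑ i ∈ S, p i + p j) := by
  simp only [overlapBound, Finset.sum_insert hj]
  ring

theorem SatisfiesQ.le {j : J} (hp : ∀ j, 0 < p j) (h : SatisfiesQ p A c) (hj : j ∈ A) :
    p j ≤ c j := by
  have := h {j} (by simpa using hj)
  simp only [overlapBound, Finset.sum_singleton] at this
  have h2 := hp j
  nlinarith

theorem SatisfiesQ.congr {c' : J → ℝ} (h : SatisfiesQ p A c) (hc : ∀ j ∈ A, c' j = c j) :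
    SatisfiesQ p A c' := by
  intro S hS
  rw [Finset.sum_congr rfl fun i hi => by rw [hc i (hS hi)]]
  exact h S hS

/-- Compare tightness of `S` with the inequality for `S` without `i`: the difference is `p i * c i ≤
p i * p(S)`. -/
theorem SatisfiesQ.le_sum_of_tight [DecidableEq J] {i : J} (hp : ∀ j, 0 < p j)
    (h : SatisfiesQ p A c) (hS : S ⊆ A)
    (ht : ∑ i ∈ S, p i * c i ≤ overlapBound p S) (hi : i ∈ S) : c i ≤ ∑ i ∈ S, p i := by
  obtain ⟨R, hR, rfl⟩ : ∃ R, i ∉ R ∧ insert i R = S :=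
    ⟨S.erase i, Finset.notMem_erase i S, Finset.insert_erase hi⟩
  have h1 := h R ((Finset.subset_insert i R).trans hS)
  rw [overlapBound_insert hR, Finset.sum_insert hR] at ht
  rw [Finset.sum_insert hR]
  have h2 := hp i
  nlinarith

theorem SatisfiesQ.sum_add_le_of_tight [DecidableEq J] {j : J} (hp : ∀ j, 0 < p j)
    (h : SatisfiesQ p A c)
    (hS : S ⊆ A) (ht : ∑ i ∈ S, p i * c i ≤ overlapBound p S) (hjA : j ∈ A) (hj : j ∉ S) :
    ∑ i ∈ S, p i + p j ≤ c j := by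
  have h1 := h (insert j S) (Finset.insert_subset hjA hS)
  rw [overlapBound_insert hj, Finset.sum_insert hj] at h1
  have h2 := hp j
  nlinarith

/-- Two tasks separated by a tight set do not overlap. -/
theorem SatisfiesQ.add_le_of_tight [DecidableEq J] {i j : J} (hp : ∀ j, 0 < p j)
    (h : SatisfiesQ p A c)
    (hS : S ⊆ A) (ht : ∑ i ∈ S, p i * c i ≤ overlapBound p S) (hi : i ∈ S) (hjA : j ∈ A)
    (hj : j ∉ S) : c i + p j ≤ c j := by
  linarith [h.le_sum_of_tight hp hS ht hi, h.sum_add_le_of_tight hp hS ht hjA hj]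

/-- A task that belongs to a tight set and completes no earlier than `p(A)` is processed after
all other tasks of `A`. -/
theorem SatisfiesQ.add_le_of_sum_le [DecidableEq J] {i j : J} (hp : ∀ j, 0 < p j)
    (h : SatisfiesQ p A c)
    (hS : S ⊆ A) (ht : ∑ i ∈ S, p i * c i ≤ overlapBound p S) (hj : j ∈ S)
    (hc : ∑ i ∈ A, p i ≤ c j) (hi : i ∈ A) (hij : i ≠ j) : c i + p j ≤ c j := by
  have h1 := h.le_sum_of_tight hp hS ht hj
  -- Tightness gives `c j ≤ p(S)`, while `c j ≥ p(A)`; positive processing times leave no room for a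
  -- proper subset.
  have hSA : S = A := by
    by_contra hne
    obtain ⟨l, hlA, hlS⟩ := Finset.exists_of_ssubset (hS.ssubset_of_ne hne)
    linarith [Finset.sum_lt_sum_of_subset hS hlA hlS (hp l) fun i _ _ => (hp i).le]
  subst hSA
  obtain ⟨R, hR, rfl⟩ : ∃ R, j ∉ R ∧ insert j R = S :=
    ⟨S.erase j, Finset.notMem_erase j S, Finset.insert_erase hj⟩
  -- Since `c j` is at least `p(A)`, removing `j` from the tight set `A` leaves a tight set, which
  -- separates every other task from `j`.
  refine h.add_le_of_tight (S := R) hp (Finset.subset_insert j R) ?_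
    ((Finset.mem_insert.1 hi).resolve_left hij) hj hR
  rw [overlapBound_insert hR, Finset.sum_insert hR] at ht
  rw [Finset.sum_insert hR] at hc
  have h2 := hp j
  nlinarith

theorem NonOverlap.mono {B : Finset J} (h : NonOverlap p A c) (hB : B ⊆ A) :
    NonOverlap p B c :=
  ⟨fun j hj => h.1 j (hB hj), fun i hi j hj => h.2 i (hB hi) j (hB hj)⟩

theorem NonOverlap.congr {c' : J → ℝ} (h : NonOverlap p A c)
    (hc : ∀ j ∈ A, c' j = c j) : NonOverlap p A c' := by
  refine ⟨fun j hj => ?_, fun i hi j hj hij => ?_⟩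
  · rw [hc j hj]
    exact h.1 j hj
  · rw [hc i hi, hc j hj]
    exact h.2 i hi j hj hij

theorem IsCompressed.congr {c' : J → ℝ} (h : IsCompressed p A c)
    (hc : ∀ j ∈ A, c' j = c j) : IsCompressed p A c' := by
  intro j hj
  rw [hc j hj]
  refine (h j hj).trans (Finset.sum_congr (Finset.filter_congr fun i hi => ?_) fun _ _ => rfl)
  rw [hc i hi]

theorem NonOverlap.add_le {i j : J} (hp : ∀ j, 0 < p j) (h : NonOverlap p A c) (hi : i ∈ A)
    (hj : j ∈ A) (hij : i ≠ j) (hc : c i ≤ c j) : c i + p j ≤ c j := by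
  rcases h.2 i hi j hj hij with h1 | h1
  · exact h1
  · linarith [hp i]

/-- Induction on the task completing last: the others are done by its start, `c a - p a`, which
serves as their bound `M`. -/
theorem NonOverlap.sum_le [DecidableEq J] (hp : ∀ j, 0 < p j) (h : NonOverlap p A c) {M : ℝ}
    (hM : 0 ≤ M)
    (hc : ∀ i ∈ A, c i ≤ M) : ∑ i ∈ A, p i ≤ M := by
  induction A using Finset.induction_on_max_value c generalizing M with
  | empty => simpa
  | insert a s ha hs ih =>
    have hmono := h.mono (Finset.subset_insert a s)
    have h1 := h.1 a (Finset.mem_insert_self a s)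
    have h2 := ih hmono (M := c a - p a) (by linarith) fun i hi => by
      linarith [h.add_le hp (Finset.mem_insert_of_mem hi) (Finset.mem_insert_self a s)
        (fun e => ha (e ▸ hi)) (hs i hi)]
    rw [Finset.sum_insert ha]
    linarith [hc a (Finset.mem_insert_self a s)]

theorem NonOverlap.compress_le [DecidableEq J] (hp : ∀ j, 0 < p j) (h : NonOverlap p A c) {j : J}
    (hj : j ∈ A) :
    compress p A c j ≤ c j :=
  (h.mono (Finset.filter_subset _ A)).sum_le hp ((hp j).le.trans (h.1 j hj))
    fun _ hi => (Finset.mem_filter.1 hi).2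

/-- Add tasks in order of completion: the last one completes no earlier than the total processing
time, which is the increment in `overlapBound_insert`. -/
theorem NonOverlap.satisfiesQ [DecidableEq J] (hp : ∀ j, 0 < p j) (h : NonOverlap p A c) :
    SatisfiesQ p A c := by
  intro S hS
  replace h := h.mono hS
  clear hS
  induction S using Finset.induction_on_max_value c with
  | empty => simp [overlapBound]
  | insert a s ha hs ih =>
    have h1 := ih (h.mono (Finset.subset_insert a s))
    have h2 : ∑ i ∈ insert a s, p i ≤ c a :=
      h.sum_le hp ((hp a).le.trans (h.1 a (Finset.mem_insert_self a s))) (by simpa using hs)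
    rw [Finset.sum_insert ha] at h2
    rw [overlapBound_insert ha, Finset.sum_insert ha]
    have h3 := hp a
    nlinarith

theorem compress_le_sum (hp : ∀ j, 0 < p j) (j : J) : compress p A c j ≤ ∑ i ∈ A, p i :=
  Finset.sum_le_sum_of_subset_of_nonneg (Finset.filter_subset _ _) fun i _ _ => (hp i).le

theorem IsCompressed.le_sum (hp : ∀ j, 0 < p j)
    (h : IsCompressed p A c) {j : J} (hj : j ∈ A) : c j ≤ ∑ i ∈ A, p i :=
  (h j hj).le.trans (compress_le_sum hp j)

theorem NonOverlap.compress_add_le [DecidableEq J] (hp : ∀ j, 0 < p j) (h : NonOverlap p A c)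
    {i j : J}
    (hi : i ∈ A) (hj : j ∈ A) (hij : i ≠ j) (hc : c i ≤ c j) :
    compress p A c i + p j ≤ compress p A c j := by
  have h1 := h.add_le hp hi hj hij hc
  have hn : j ∉ A.filter fun l => c l ≤ c i := by
    simp only [Finset.mem_filter, not_and, not_le]
    intro _
    linarith [hp j]
  rw [compress, add_comm, ← Finset.sum_insert hn]
  refine Finset.sum_le_sum_of_subset_of_nonneg ?_ fun i _ _ => (hp i).le
  intro l hl
  simp only [Finset.mem_insert, Finset.mem_filter] at hl ⊢
  rcases hl with rfl | ⟨hl, hl'⟩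
  · exact ⟨hj, le_rfl⟩
  · exact ⟨hl, hl'.trans hc⟩

theorem NonOverlap.compress [DecidableEq J] (hp : ∀ j, 0 < p j) (h : NonOverlap p A c) :
    NonOverlap p A (compress p A c) := by
  refine ⟨fun j hj => ?_, fun i hi j hj hij => ?_⟩
  · exact Finset.single_le_sum (f := p) (fun i _ => (hp i).le)
      (Finset.mem_filter.2 ⟨hj, le_rfl⟩)
  · rcases le_total (c i) (c j) with hc | hc
    · exact Or.inl (h.compress_add_le hp hi hj hij hc)
    · exact Or.inr (h.compress_add_le hp hj hi hij.symm hc)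

/-- Compression preserves the order of completion, so the sets of predecessors over which one sums
are the same for `c` and for its compression. -/
theorem NonOverlap.isCompressed_compress [DecidableEq J] (hp : ∀ j, 0 < p j)
    (h : NonOverlap p A c) :
    IsCompressed p A (CommonDueDate.compress p A c) := by
  intro j hj
  refine Finset.sum_congr (Finset.filter_congr fun i hi => ?_) fun _ _ => rfl
  by_cases hij : i = j
  · simp [hij]
  rcases le_total (c i) (c j) with hc | hc
  · have := h.compress_add_le hp hi hj hij hc
    exact iff_of_true hc (by linarith [hp j])
  · have h1 := h.compress_add_le hp hj hi (Ne.symm hij) hc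
    have h2 := h.add_le hp hj hi (Ne.symm hij) hc
    exact iff_of_false (by linarith [hp i]) (by linarith [hp i])

theorem IsCompressed.of_insert [DecidableEq J] {a : J} (hp : ∀ j, 0 < p j)
    (hA : NonOverlap p (insert a A) c)
    (h : IsCompressed p (insert a A) c) (ha : a ∉ A) (hmax : ∀ i ∈ A, c i ≤ c a) :
    IsCompressed p A c := by
  intro j hj
  have h1 := hA.add_le hp (Finset.mem_insert_of_mem hj) (Finset.mem_insert_self a A)
    (fun e => ha (e ▸ hj)) (hmax j hj)
  have h2 := h j (Finset.mem_insert_of_mem hj)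
  rwa [Finset.filter_insert, if_neg (by linarith [hp a])] at h2

theorem IsCompressed.sum_eq [DecidableEq J] {a : J} (h : IsCompressed p (insert a A) c)
    (hmax : ∀ i ∈ A, c i ≤ c a) : c a = ∑ i ∈ insert a A, p i := by
  rw [h a (Finset.mem_insert_self a A), Finset.filter_true_of_mem]
  simpa using hmax

theorem IsCompressed.tight [DecidableEq J] (hp : ∀ j, 0 < p j) (hA : NonOverlap p A c)
    (h : IsCompressed p A c) : ∑ i ∈ A, p i * c i = overlapBound p A := by
  induction A using Finset.induction_on_max_value c with
  | empty => simp [overlapBound]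
  | insert a s ha hs ih =>
    rw [overlapBound_insert ha, Finset.sum_insert ha,
      ih (hA.mono (Finset.subset_insert a s)) (h.of_insert hp hA ha hs), h.sum_eq hs,
      Finset.sum_insert ha]
    ring

/-- Compressed schedules are extreme among the solutions of the nonoverlapping inequalities. -/
theorem IsCompressed.eq_of_combo [DecidableEq J] {y z : J → ℝ} {s t : ℝ} (hp : ∀ j, 0 < p j)
    (hA : NonOverlap p A c) (h : IsCompressed p A c) (hs : 0 < s) (ht : 0 < t) (hst : s + t = 1)
    (hy : SatisfiesQ p A y) (hz : SatisfiesQ p A z) (hc : ∀ j ∈ A, s * y j + t * z j = c j) :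
    ∀ j ∈ A, y j = c j := by
  induction A using Finset.induction_on_max_value c with
  | empty => simp
  | insert a S ha hS ih =>
    have hsub := Finset.subset_insert a S
    have hy' := ih (hA.mono hsub) (h.of_insert hp hA ha hS) (fun R hR => hy R (hR.trans hsub))
      (fun R hR => hz R (hR.trans hsub)) fun j hj => hc j (hsub hj)
    have hzS : ∀ j ∈ S, z j = c j := fun j hj => by
      have h1 := hc j (hsub hj)
      rw [hy' j hj] at h1
      have h2 : t * (z j - c j) = 0 := by linear_combination h1 - c j * hst
      linarith [(mul_eq_zero.1 h2).resolve_left ht.ne']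
    -- By induction `y` and `z` agree with `c` before the last task `a`. Tightness of the whole set
    -- bounds both `y a` and `z a` below by `c a`, of which `c a` is a convex combination.
    have htight := h.tight hp hA
    have h1 := hy _ subset_rfl
    have h2 := hz _ subset_rfl
    rw [← htight, Finset.sum_insert ha, Finset.sum_insert ha] at h1 h2
    rw [Finset.sum_congr rfl fun i hi => by rw [← hy' i hi]] at h1
    rw [Finset.sum_congr rfl fun i hi => by rw [← hzS i hi]] at h2
    have h3 : c a ≤ y a := le_of_mul_le_mul_left (by linarith) (hp a)
    have h4 : c a ≤ z a := le_of_mul_le_mul_left (by linarith) (hp a)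
    have h5 := hc a (Finset.mem_insert_self a S)
    intro j hj
    rcases Finset.mem_insert.1 hj with rfl | hj
    · have h6 : s * (y j - c j) + t * (z j - c j) = 0 := by linear_combination h5 - c j * hst
      nlinarith [mul_nonneg ht.le (sub_nonneg.2 h4)]
    · exact hy' j hj

open Filter Topology in
/-- A direction along which the tight inequalities stay tight preserves the nonoverlapping
inequalities locally. -/
theorem SatisfiesQ.eventually_add_smul (v : J → ℝ)
    (h : SatisfiesQ p A c)
    (hv : ∀ S ⊆ A, ∑ i ∈ S, p i * c i ≤ overlapBound p S → ∑ i ∈ S, p i * v i = 0) :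
    ∀ᶠ ε in 𝓝 (0 : ℝ), SatisfiesQ p A (c + ε • v) := by
  have : ∀ᶠ ε in 𝓝 (0 : ℝ), ∀ S ∈ A.powerset,
      overlapBound p S ≤ ∑ i ∈ S, p i * (c + ε • v) i := by
    rw [Filter.eventually_all_finset]
    intro S hS
    have hsum : ∀ ε : ℝ, ∑ i ∈ S, p i * (c + ε • v) i
        = ∑ i ∈ S, p i * c i + ε * ∑ i ∈ S, p i * v i := fun ε => by
      rw [Finset.mul_sum, ← Finset.sum_add_distrib]
      refine Finset.sum_congr rfl fun i _ => ?_
      simp only [Pi.add_apply, Pi.smul_apply, smul_eq_mul]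
      ring
    simp only [hsum]
    have hS' := Finset.mem_powerset.1 hS
    -- Tight sets are unaffected by `v`; a strict inequality persists for small `ε` by continuity.
    by_cases ht : ∑ i ∈ S, p i * c i ≤ overlapBound p S
    · rw [hv S hS' ht]
      exact Eventually.of_forall fun ε => by simpa using h S hS'
    · have hcont : Tendsto (fun ε : ℝ => ∑ i ∈ S, p i * c i + ε * ∑ i ∈ S, p i * v i) (𝓝 0)
          (𝓝 (∑ i ∈ S, p i * c i + 0 * ∑ i ∈ S, p i * v i)) :=
        Continuous.tendsto (by fun_prop) 0
      rw [zero_mul, add_zero] at hcont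
      exact (hcont.eventually (lt_mem_nhds (not_le.1 ht))).mono fun ε hε => hε.le
  filter_upwards [this] with ε hε S hS using hε S (Finset.mem_powerset.2 hS)

/-- If the processing intervals of `A` cover `(0, M)`, then `M ≤ p(A)`. -/
theorem le_sum_of_cover (hp : ∀ j, 0 < p j) {M : ℝ}
    (h : ∀ u, 0 < u → u < M → ∃ i ∈ A, c i - p i ≤ u ∧ u ≤ c i) : M ≤ ∑ i ∈ A, p i := by
  have h1 : Set.Ioo 0 M ⊆ ⋃ i ∈ A, Set.Icc (c i - p i) (c i) := by
    intro u hu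
    obtain ⟨i, hi, hu'⟩ := h u hu.1 hu.2
    exact Set.mem_biUnion hi hu'
  -- Subadditivity of Lebesgue measure.
  have h2 := (MeasureTheory.measure_mono h1).trans
    (MeasureTheory.measure_biUnion_finset_le (μ := MeasureTheory.volume) A _)
  simp only [Real.volume_Ioo, Real.volume_Icc, sub_zero, sub_sub_cancel] at h2
  rw [← ENNReal.ofReal_sum_of_nonneg fun i _ => (hp i).le] at h2
  exact (ENNReal.ofReal_le_ofReal_iff (Finset.sum_nonneg fun i _ => (hp i).le)).1 h2

theorem IsCompressed.exists_busy [DecidableEq J] (hp : ∀ j, 0 < p j) (hA : NonOverlap p A c)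
    (h : IsCompressed p A c) {u : ℝ} (hu : 0 ≤ u) (hex : ∃ i ∈ A, u < c i) :
    ∃ j ∈ A, c j - p j ≤ u ∧ u < c j := by
  obtain ⟨i, hi, hui⟩ := hex
  -- The first task completing after `u` is the busy one: its predecessors all complete by `u`, and
  -- their total processing time is its starting time.
  obtain ⟨j, hj, hmin⟩ := (A.filter fun i => u < c i).exists_min_image c
    ⟨i, Finset.mem_filter.2 ⟨hi, hui⟩⟩
  obtain ⟨hjA, huj⟩ := Finset.mem_filter.1 hj
  refine ⟨j, hjA, ?_, huj⟩
  have hmem : j ∈ A.filter fun i => c i ≤ c j := Finset.mem_filter.2 ⟨hjA, le_rfl⟩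
  have h1 := Finset.sum_erase_add _ p hmem
  rw [← h j hjA] at h1
  have h2 : ∑ i ∈ (A.filter fun i => c i ≤ c j).erase j, p i ≤ u := by
    refine (hA.mono ((Finset.erase_subset _ _).trans (Finset.filter_subset _ _))).sum_le hp hu ?_
    intro i hi
    simp only [Finset.mem_erase, Finset.mem_filter] at hi
    by_contra hlt
    have h3 := hmin i (Finset.mem_filter.2 ⟨hi.2.1, not_le.1 hlt⟩)
    linarith [hA.add_le hp hi.2.1 hjA hi.1 hi.2.2, hp j]
  linarith

/-- Reflection in time turns processing intervals closed on the left into intervals closed on the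
right; this version serves the early side. -/
theorem IsCompressed.exists_busy' [DecidableEq J] (hp : ∀ j, 0 < p j) (hA : NonOverlap p A c)
    (h : IsCompressed p A c) {u : ℝ} (hu : 0 < u) (hex : ∃ i ∈ A, u ≤ c i) :
    ∃ j ∈ A, c j - p j < u ∧ u ≤ c j := by
  obtain ⟨i, hi, hui⟩ := hex
  obtain ⟨j, hj, hmin⟩ := (A.filter fun i => u ≤ c i).exists_min_image c
    ⟨i, Finset.mem_filter.2 ⟨hi, hui⟩⟩
  obtain ⟨hjA, huj⟩ := Finset.mem_filter.1 hj
  refine ⟨j, hjA, ?_, huj⟩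
  have hmem : j ∈ A.filter fun i => c i ≤ c j := Finset.mem_filter.2 ⟨hjA, le_rfl⟩
  have h1 := Finset.sum_erase_add _ p hmem
  rw [← h j hjA] at h1
  have hR := hA.mono ((Finset.erase_subset j _).trans
    (Finset.filter_subset (fun i => c i ≤ c j) A))
  have hlt : ∀ i ∈ (A.filter fun i => c i ≤ c j).erase j, c i < u := by
    intro i hi
    simp only [Finset.mem_erase, Finset.mem_filter] at hi
    by_contra hlt
    have h3 := hmin i (Finset.mem_filter.2 ⟨hi.2.1, not_lt.1 hlt⟩)
    linarith [hA.add_le hp hi.2.1 hjA hi.1 hi.2.2, hp j]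
  have h2 : ∑ i ∈ (A.filter fun i => c i ≤ c j).erase j, p i < u := by
    rcases ((A.filter fun i => c i ≤ c j).erase j).eq_empty_or_nonempty with he | hne
    · rwa [he, Finset.sum_empty]
    · obtain ⟨m, hm, hmax⟩ := Finset.exists_max_image _ c hne
      exact (hR.sum_le hp ((hp m).le.trans (hR.1 m hm)) hmax).trans_lt (hlt m hm)
  linarith

end Polymatroid

/-! ### Integer points of the polyhedron as slices in the coordinates `(c, a)`. -/

section Parametrization

variable {J : Type*} [LinearOrder J]

/-- The `(δ,γ)`-integer vector of `ℝ^J × ℝ^J × …` for which `T` is the set of tasks after the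
reference point `d - a`, `k` is the designated first task of `T`, and `c j` is the tardiness of
`j ∈ T`, respectively the sum of the earliness and the processing time of `j ∉ T`. -/
noncomputable def integerPoint (p : J → ℝ) (T : Finset J) (k : J) (x : (J → ℝ) × ℝ) : Point J :=
  (fun j => if j ∈ T then 0 else x.1 j - p j, fun j => if j ∈ T then x.1 j else 0,
    fun j => if j ∈ T then 0 else 1,
    fun q => |(if q.1.1 ∈ T then (0 : ℝ) else 1) - (if q.1.2 ∈ T then 0 else 1)|, x.2,
    fun j => if j ∈ T then 0 else x.2, fun j => if j = k then 1 else 0)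

/-- The constraints on `(c, a)` for `integerPoint p T k (c, a)` to lie in `P³`. -/
structure InSlice [Fintype J] (p : J → ℝ) (d : ℝ) (T : Finset J) (k : J) (x : (J → ℝ) × ℝ) :
    Prop where
  mem : k ∈ T
  tardy : SatisfiesQ p T x.1
  early : SatisfiesQ p Tᶜ x.1
  le_sum : ∀ j, x.1 j ≤ ∑ i, p i
  first_le : x.1 k ≤ p k
  le_sub : ∀ j ∉ T, x.1 j ≤ d - x.2
  sum_le_sub : ∑ j ∈ Tᶜ, p j ≤ d - x.2
  nonneg : 0 ≤ x.2
  shift_le : x.2 ≤ p k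

variable {p : J → ℝ} {d : ℝ} {T : Finset J} {k : J} {x : (J → ℝ) × ℝ}

theorem InSlice.proc_le [Fintype J] (hp : ∀ j, 0 < p j) (h : InSlice p d T k x) (j : J) :
    p j ≤ x.1 j := by
  by_cases hj : j ∈ T
  · exact h.tardy.le hp hj
  · exact h.early.le hp (Finset.mem_compl.2 hj)

theorem InSlice.first_eq [Fintype J] (hp : ∀ j, 0 < p j) (h : InSlice p d T k x) : x.1 k = p k :=
  h.first_le.antisymm (h.proc_le hp k)

theorem InSlice.shift_le_dueDate [Fintype J] (hp : ∀ j, 0 < p j) (h : InSlice p d T k x) :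
    x.2 ≤ d := by
  linarith [h.sum_le_sub, Finset.sum_nonneg fun j (_ : j ∈ Tᶜ) => (hp j).le]

/-- For binary `δ` the pair coefficients in the nonoverlapping inequalities are products of
indicators, so this identity applies with `u` equal to `p` truncated to one side of the reference
point. -/
theorem sum_pairsIn_mul [Fintype J] (u : J → ℝ) (S : Finset J) :
    ∑ q ∈ pairsIn S, u q.1.1 * u q.1.2 = ((∑ i ∈ S, u i) ^ 2 - ∑ i ∈ S, u i ^ 2) / 2 := by
  induction S using Finset.induction_on_max with
  | empty => simp [pairsIn]
  | insert a s hs ih =>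
    have ha : a ∉ s := fun h => lt_irrefl a (hs a h)
    have hsplit : ∑ q ∈ pairsIn (insert a s), u q.1.1 * u q.1.2
        = ∑ q ∈ pairsIn s, u q.1.1 * u q.1.2 + ∑ i ∈ s, u i * u a := by
      -- Since `a` is the maximum, the new pairs are exactly `(i, a)` with `i ∈ s`.
      rw [← Finset.sum_filter_add_sum_filter_not (pairsIn (insert a s)) fun q => q.1.2 ∈ s]
      congr 1
      · refine Finset.sum_congr ?_ fun _ _ => rfl
        ext q
        simp only [pairsIn, Finset.mem_filter, Finset.mem_univ, true_and, Finset.mem_insert]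
        constructor
        · rintro ⟨⟨h1 | h1, _⟩, h2⟩
          · exact absurd (h1 ▸ q.2) (hs _ h2).not_gt
          · exact ⟨h1, h2⟩
        · rintro ⟨h1, h2⟩
          exact ⟨⟨Or.inr h1, Or.inr h2⟩, h2⟩
      · refine Finset.sum_bij' (fun q _ => q.1.1)
          (fun i hi => if h : i < a then ⟨(i, a), h⟩ else ⟨(i, a), (h (hs i hi)).elim⟩)
          ?_ ?_ ?_ ?_ ?_
        · intro q hq
          simp only [pairsIn, Finset.mem_filter, Finset.mem_univ, true_and,
            Finset.mem_insert] at hq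
          obtain ⟨⟨h1, h2⟩, h3⟩ := hq
          rcases h1 with h1 | h1
          · have h4 := h2.resolve_right h3
            exact absurd q.2 (by rw [h1, h4]; exact lt_irrefl a)
          · exact h1
        · intro i hi
          simp [pairsIn, hs i hi, hi, ha]
        · intro q hq
          simp only [pairsIn, Finset.mem_filter, Finset.mem_univ, true_and,
            Finset.mem_insert] at hq
          have h4 := hq.1.2.resolve_right hq.2
          have h5 := q.2
          apply Subtype.ext
          rw [h4] at h5
          simp [← h4]
        · intro i hi
          simp [hs i hi]
        · intro q hq
          simp only [pairsIn, Finset.mem_filter, Finset.mem_univ, true_and,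
            Finset.mem_insert] at hq
          rw [hq.1.2.resolve_right hq.2]
    rw [hsplit, ih, Finset.sum_insert ha, Finset.sum_insert ha, ← Finset.sum_mul]
    ring

/-- The coefficients of the early nonoverlapping inequality at a `0`-`1` vector `δ`. -/
theorem sum_pairsIn_early [Fintype J] (S : Finset J) :
    ∑ q ∈ pairsIn S, p q.1.1 * p q.1.2 * ((delta (integerPoint p T k x) q.1.1
      + delta (integerPoint p T k x) q.1.2 - cross (integerPoint p T k x) q) / 2)
      = overlapBound p (S \ T) - ∑ i ∈ S \ T, p i ^ 2 := by
  have h := sum_pairsIn_mul (fun i => if i ∈ T then 0 else p i) S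
  have h1 : ∑ i ∈ S, (if i ∈ T then 0 else p i) = ∑ i ∈ S \ T, p i := by
    rw [Finset.sdiff_eq_filter, Finset.sum_filter]
    simp [ite_not]
  have h2 : ∑ i ∈ S, (if i ∈ T then 0 else p i) ^ 2 = ∑ i ∈ S \ T, p i ^ 2 := by
    rw [Finset.sdiff_eq_filter, Finset.sum_filter]
    simp [ite_not, ite_pow]
  rw [h1, h2] at h
  rw [overlapBound, show ((∑ i ∈ S \ T, p i) ^ 2 + ∑ i ∈ S \ T, p i ^ 2) / 2
    - ∑ i ∈ S \ T, p i ^ 2 = ((∑ i ∈ S \ T, p i) ^ 2 - ∑ i ∈ S \ T, p i ^ 2) / 2 by ring, ← h]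
  refine Finset.sum_congr rfl fun q _ => ?_
  simp only [integerPoint, delta, cross]
  split_ifs <;> norm_num

/-- The coefficients of the tardy nonoverlapping inequality at a `0`-`1` vector `δ`. -/
theorem sum_pairsIn_tardy [Fintype J] (S : Finset J) :
    ∑ q ∈ pairsIn S, p q.1.1 * p q.1.2 * ((2 - (delta (integerPoint p T k x) q.1.1
      + delta (integerPoint p T k x) q.1.2) - cross (integerPoint p T k x) q) / 2)
      + ∑ i ∈ S, p i ^ 2 * (1 - delta (integerPoint p T k x) i)
      = overlapBound p (S ∩ T) := by
  have h := sum_pairsIn_mul (fun i => if i ∈ T then p i else 0) S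
  have h1 : ∑ i ∈ S, (if i ∈ T then p i else 0) = ∑ i ∈ S ∩ T, p i := by
    rw [← Finset.filter_mem_eq_inter, Finset.sum_filter]
  have h2 : ∑ i ∈ S, (if i ∈ T then p i else 0) ^ 2 = ∑ i ∈ S ∩ T, p i ^ 2 := by
    rw [← Finset.filter_mem_eq_inter, Finset.sum_filter]
    simp [ite_pow]
  have h3 : ∑ i ∈ S, p i ^ 2 * (1 - delta (integerPoint p T k x) i) = ∑ i ∈ S ∩ T, p i ^ 2 := by
    rw [← h2]
    refine Finset.sum_congr rfl fun i _ => ?_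
    simp only [integerPoint, delta]
    split_ifs <;> norm_num
  rw [h1, h2] at h
  rw [h3, overlapBound, show ((∑ i ∈ S ∩ T, p i) ^ 2 + ∑ i ∈ S ∩ T, p i ^ 2) / 2
    = ((∑ i ∈ S ∩ T, p i) ^ 2 - ∑ i ∈ S ∩ T, p i ^ 2) / 2 + ∑ i ∈ S ∩ T, p i ^ 2 by ring, ← h]
  congr 1
  refine Finset.sum_congr rfl fun q _ => ?_
  simp only [integerPoint, delta, cross]
  split_ifs <;> norm_num

theorem sum_mul_early (S : Finset J) :
    ∑ i ∈ S, p i * early (integerPoint p T k x) i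
      = ∑ i ∈ S \ T, p i * x.1 i - ∑ i ∈ S \ T, p i ^ 2 := by
  rw [Finset.sdiff_eq_filter, Finset.sum_filter, Finset.sum_filter, ← Finset.sum_sub_distrib]
  refine Finset.sum_congr rfl fun i _ => ?_
  simp only [integerPoint, early]
  split_ifs
  · ring
  · ring

theorem sum_mul_tardy (S : Finset J) :
    ∑ i ∈ S, p i * tardy (integerPoint p T k x) i = ∑ i ∈ S ∩ T, p i * x.1 i := by
  rw [← Finset.filter_mem_eq_inter, Finset.sum_filter]
  refine Finset.sum_congr rfl fun i _ => ?_
  simp only [integerPoint, tardy]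
  split_ifs
  · rfl
  · ring

theorem sum_mul_delta [Fintype J] :
    ∑ j, p j * delta (integerPoint p T k x) j = ∑ j ∈ Tᶜ, p j := by
  rw [Finset.compl_eq_univ_sdiff, Finset.sdiff_eq_filter, Finset.sum_filter]
  refine Finset.sum_congr rfl fun i _ => ?_
  simp only [integerPoint, delta]
  split_ifs <;> simp

theorem integerPoint_mem_P3 [Fintype J] (hp : ∀ j, 0 < p j) (h : InSlice p d T k x) :
    integerPoint p T k x ∈ P3 p d := by
  have hc := h.proc_le hp
  have had := h.shift_le_dueDate hp
  have ha := h.nonneg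
  have hk := h.mem
  have hP : ∀ j, p j ≤ ∑ i, p i := fun j =>
    Finset.single_le_sum (f := p) (fun i _ => (hp i).le) (Finset.mem_univ j)
  refine ⟨?_, ?_, ?_, ?_, ?_, ?_, ?_, ?_, ?_, ?_, ?_, ?_, ?_, ?_, ?_, ?_, ?_, ?_, ?_, ?_, ?_, ?_,
    ?_, ?_, ?_⟩
  all_goals first
    | (intro j
       have h1 := hc j
       have h2 := h.le_sum j
       have h3 := hp j
       have h4 := hP j
       simp only [integerPoint, delta, gam, early, tardy, shift, prodv]
       split_ifs with h5 <;> first | linarith | skip)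
    | skip
  all_goals first
    | (intro q
       simp only [integerPoint, delta, cross]
       split_ifs <;> norm_num)
    | skip
  · linarith [h.le_sub _ ‹_›]
  · rw [sum_mul_delta]
    exact h.sum_le_sub
  · exact ha
  · subst h5
    linarith [h.shift_le]
  · simp [integerPoint, gam]
  · subst_vars
    exact absurd hk h5
  · subst_vars
    linarith [h.first_le]
  · intro S
    rw [sum_pairsIn_early, sum_mul_early]
    linarith [h.early (S \ T) fun i hi => Finset.mem_compl.2 (Finset.mem_sdiff.1 hi).2]
  · intro S
    rw [sum_pairsIn_tardy, sum_mul_tardy]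
    exact h.tardy _ Finset.inter_subset_right

/-- For binary `δ` the linearization is exact: `x` is forced to `|δ_i - δ_j|`, `b` to `a * δ`, and
the earliness or tardiness on the wrong side to zero. -/
theorem eq_integerPoint [Fintype J] {X : Point J} (hX : X ∈ P3 p d)
    (hδ : ∀ j, delta X j = if j ∈ T then 0 else 1) (hγ : ∀ j, gam X j = if j = k then 1 else 0) :
    X = integerPoint p T k (fun j => if j ∈ T then tardy X j else early X j + p j, shift X) := by
  have h1 := hX.early_nonneg
  have h2 := hX.early_le
  have h3 := hX.tardy_nonneg
  have h4 := hX.tardy_le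
  have h5 := hX.cross_ge
  have h6 := hX.cross_ge'
  have h7 := hX.cross_le
  have h8 := hX.cross_le'
  have h9 := hX.prodv_nonneg
  have h10 := hX.prodv_le_shift
  have h11 := hX.prodv_le
  have h12 := hX.prodv_ge
  simp only [hδ] at h1 h2 h3 h4 h5 h6 h7 h8 h9 h10 h11 h12
  refine Prod.ext (funext fun j => ?_) (Prod.ext (funext fun j => ?_) (Prod.ext (funext fun j => ?_)
    (Prod.ext (funext fun q => ?_) (Prod.ext rfl (Prod.ext (funext fun j => ?_)
      (funext fun j => ?_))))))
  · specialize h1 j; specialize h2 j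
    change early X j = _
    simp only [integerPoint]
    split_ifs with h
    · rw [if_pos h] at h2; linarith
    · ring
  · specialize h3 j; specialize h4 j
    change tardy X j = _
    simp only [integerPoint]
    split_ifs with h
    · rfl
    · rw [if_neg h] at h4; linarith
  · exact hδ j
  · specialize h5 q; specialize h6 q; specialize h7 q; specialize h8 q
    change cross X q = _
    simp only [integerPoint]
    split_ifs at h5 h6 h7 h8 ⊢ <;> norm_num at h5 h6 h7 h8 ⊢ <;> linarith
  · specialize h9 j; specialize h10 j; specialize h11 j; specialize h12 j
    change prodv X j = _
    simp only [integerPoint]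
    split_ifs at h11 h12 ⊢ <;> linarith
  · exact hγ j

theorem inSlice_of_mem_P3 [Fintype J] (h : integerPoint p T k x ∈ P3 p d) :
    InSlice p d T k x := by
  have hk : k ∈ T := by
    have := h.delta_le_gam k
    by_contra hk
    simp [integerPoint, delta, gam, hk] at this
    linarith
  refine ⟨hk, fun S hS => ?_, fun S hS => ?_, fun j => ?_, ?_, fun j hj => ?_, ?_,
    h.shift_nonneg, ?_⟩
  · have := h.nonoverlap_tardy S
    rwa [sum_pairsIn_tardy, sum_mul_tardy, Finset.inter_eq_left.2 hS] at this
  · have := h.nonoverlap_early S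
    rw [sum_pairsIn_early, sum_mul_early, Finset.sdiff_eq_self_of_disjoint
      (Finset.subset_compl_iff_disjoint_right.1 hS)] at this
    linarith
  · have h1 := h.early_le j
    have h2 := h.tardy_le j
    simp only [integerPoint, delta, early, tardy] at h1 h2
    split_ifs at h1 h2 <;> linarith
  · have := h.tardy_le_gam k
    simpa [integerPoint, tardy, gam, hk] using this
  · have := h.early_add_le j
    simp only [integerPoint, delta, early, shift, if_neg hj] at this
    linarith
  · have := h.sum_delta_le
    rwa [sum_mul_delta] at this
  · have := h.shift_le k
    simpa [integerPoint, shift, gam] using this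

theorem exists_integerPoint [Fintype J] {X : Point J} (hX : X ∈ P3 p d)
    (hδ : ∀ j, delta X j = 0 ∨ delta X j = 1) (hγ : ∀ j, gam X j = 0 ∨ gam X j = 1) :
    ∃ T k x, X = integerPoint p T k x ∧ InSlice p d T k x := by
  obtain ⟨k, hk⟩ : ∃ k, gam X k = 1 := by
    by_contra! hne
    have := hX.sum_gam
    rw [Finset.sum_eq_zero fun j _ => (hγ j).resolve_right (hne j)] at this
    exact zero_ne_one this
  have hγ' : ∀ j, gam X j = if j = k then 1 else 0 := by
    intro j
    split_ifs with hj
    · rw [hj, hk]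
    · have h1 := hX.sum_gam
      rw [← Finset.add_sum_erase _ _ (Finset.mem_univ k), hk] at h1
      have h2 := Finset.single_le_sum (fun i _ => hX.gam_nonneg i)
        (Finset.mem_erase.2 ⟨hj, Finset.mem_univ j⟩)
      linarith [hX.gam_nonneg j]
  have hX' := eq_integerPoint (T := Finset.univ.filter fun j => delta X j = 0) (k := k) hX
    (fun j => by
      rcases hδ j with h | h <;> simp [h]) hγ'
  exact ⟨_, k, _, hX', inSlice_of_mem_P3 (hX' ▸ hX)⟩

theorem integerPoint_injective : Function.Injective (integerPoint p T k) := by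
  intro x y h
  have h1 := congrFun (congrArg early h)
  have h2 := congrFun (congrArg tardy h)
  refine Prod.ext (funext fun j => ?_) (congrArg shift h)
  specialize h1 j
  specialize h2 j
  simp only [integerPoint, early, tardy] at h1 h2
  split_ifs at h1 h2 <;> linarith

theorem integerPoint_combo (x y : (J → ℝ) × ℝ) {s t : ℝ} (hst : s + t = 1) :
    integerPoint p T k (s • x + t • y)
      = s • integerPoint p T k x + t • integerPoint p T k y := by
  have ht : t = 1 - s := by linarith
  subst ht
  refine Prod.ext (funext fun j => ?_) (Prod.ext (funext fun j => ?_) (Prod.ext (funext fun j => ?_)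
    (Prod.ext (funext fun q => ?_) (Prod.ext rfl (Prod.ext (funext fun j => ?_)
      (funext fun j => ?_)))))) <;>
  · simp only [integerPoint, Prod.fst_add, Prod.snd_add, Prod.smul_fst, Prod.smul_snd,
      Pi.add_apply, Pi.smul_apply, smul_eq_mul]
    split_ifs <;> ring

/-- The set of pairs `(c, a)` satisfying the constraints. -/
def slice [Fintype J] (p : J → ℝ) (d : ℝ) (T : Finset J) (k : J) :
    Set ((J → ℝ) × ℝ) := {x | InSlice p d T k x}

theorem eq_of_combo_zero_one {u v s t w : ℝ} (hs : 0 < s) (ht : 0 < t) (hst : s + t = 1)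
    (hw : w = 0 ∨ w = 1) (h : s * u + t * v = w) (hu : 0 ≤ u) (hu' : u ≤ 1) (hv : 0 ≤ v)
    (hv' : v ≤ 1) : u = w := by
  rcases hw with rfl | rfl
  · nlinarith [mul_nonneg ht.le hv]
  · nlinarith [mul_nonneg ht.le (sub_nonneg.2 hv')]

/-- The map `integerPoint` is affine and injective. Its image is a face: `δ` and `γ` range over `[0,
1]`, so a segment through a point where they are binary keeps them constant, and its endpoints have
the same `T` and `k`. -/
theorem integerPoint_mem_extremePoints_iff [Fintype J] (hp : ∀ j, 0 < p j) :
    integerPoint p T k x ∈ (P3 p d).extremePoints ℝ ↔ x ∈ (slice p d T k).extremePoints ℝ := by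
  constructor
  · rintro ⟨hx, hext⟩
    refine ⟨inSlice_of_mem_P3 hx, fun y hy z hz hxyz => ?_⟩
    obtain ⟨s, t, hs, ht, hst, rfl⟩ := hxyz
    exact integerPoint_injective (hext (integerPoint_mem_P3 hp hy) (integerPoint_mem_P3 hp hz)
      ⟨s, t, hs, ht, hst, (integerPoint_combo y z hst).symm⟩)
  · rintro ⟨hx, hext⟩
    refine ⟨integerPoint_mem_P3 hp hx, fun Y hY Z hZ hXYZ => ?_⟩
    obtain ⟨s, t, hs, ht, hst, hX⟩ := hXYZ
    have key : ∀ Y Z : Point J, Y ∈ P3 p d → Z ∈ P3 p d → ∀ s t : ℝ, 0 < s → 0 < t → s + t = 1 →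
        s • Y + t • Z = integerPoint p T k x →
          ∃ y, integerPoint p T k y = Y ∧ InSlice p d T k y := by
      intro Y Z hY hZ s t hs ht hst hX
      have h := eq_integerPoint (T := T) (k := k) hY
        (fun j => eq_of_combo_zero_one hs ht hst (by split_ifs <;> simp)
          (congrFun (congrArg delta hX) j : s * delta Y j + t * delta Z j = _)
          (hY.delta_nonneg j) (hY.delta_le_one j)
          (hZ.delta_nonneg j) (hZ.delta_le_one j))
        (fun j => eq_of_combo_zero_one hs ht hst (by split_ifs <;> simp)
          (congrFun (congrArg gam hX) j : s * gam Y j + t * gam Z j = _)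
          (hY.gam_nonneg j) (hY.gam_le_one j)
          (hZ.gam_nonneg j) (hZ.gam_le_one j))
      exact ⟨_, h.symm, inSlice_of_mem_P3 (h ▸ hY)⟩
    obtain ⟨y, rfl, hy⟩ := key Y Z hY hZ s t hs ht hst hX
    obtain ⟨z, rfl, hz⟩ := key Z _ hZ hY t s ht hs (by linarith) (by rw [add_comm, hX])
    rw [← integerPoint_combo y z hst] at hX
    exact congrArg _ (hext hy hz ⟨s, t, hs, ht, hst, integerPoint_injective hX⟩)

/-- The objective function in terms of `(c, a)`. -/
noncomputable def sliceCost [Fintype J] (p alpha beta : J → ℝ) (T : Finset J)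
    (x : (J → ℝ) × ℝ) : ℝ :=
  ∑ j, if j ∈ T then beta j * (x.1 j - x.2) else alpha j * (x.2 + (x.1 j - p j))

theorem objective_integerPoint [Fintype J] (alpha beta : J → ℝ) :
    objective alpha beta (integerPoint p T k x) = sliceCost p alpha beta T x := by
  refine Finset.sum_congr rfl fun j _ => ?_
  simp only [integerPoint, early, tardy, prodv, shift]
  split_ifs <;> ring

theorem isCompact_slice [Fintype J] (hp : ∀ j, 0 < p j) : IsCompact (slice p d T k) := by
  have hset : slice p d T k = {x | k ∈ T} ∩ {x | SatisfiesQ p T x.1} ∩ {x | SatisfiesQ p Tᶜ x.1} ∩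
      {x | ∀ j, x.1 j ≤ ∑ i, p i} ∩ {x | x.1 k ≤ p k} ∩ {x | ∀ j ∉ T, x.1 j ≤ d - x.2} ∩
      {x | ∑ j ∈ Tᶜ, p j ≤ d - x.2} ∩ {x | 0 ≤ x.2} ∩ {x | x.2 ≤ p k} := by
    ext x
    constructor
    · rintro ⟨h1, h2, h3, h4, h5, h6, h7, h8, h9⟩
      exact ⟨⟨⟨⟨⟨⟨⟨⟨h1, h2⟩, h3⟩, h4⟩, h5⟩, h6⟩, h7⟩, h8⟩, h9⟩
    · rintro ⟨⟨⟨⟨⟨⟨⟨⟨h1, h2⟩, h3⟩, h4⟩, h5⟩, h6⟩, h7⟩, h8⟩, h9⟩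
      exact ⟨h1, h2, h3, h4, h5, h6, h7, h8, h9⟩
  have hQ : ∀ A : Finset J, IsClosed {x : (J → ℝ) × ℝ | SatisfiesQ p A x.1} := by
    intro A
    simp only [SatisfiesQ, Set.ofPred_forall]
    exact isClosed_iInter fun S => isClosed_iInter fun _ =>
      isClosed_le (by fun_prop) (by fun_prop)
  have hclosed : IsClosed (slice p d T k) := by
    rw [hset]
    refine ((((((((isClosed_const).inter (hQ T)).inter (hQ Tᶜ)).inter ?_).inter ?_).inter
      ?_).inter ?_).inter ?_).inter ?_
    · simp only [Set.ofPred_forall]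
      exact isClosed_iInter fun j => isClosed_le (by fun_prop) (by fun_prop)
    · exact isClosed_le (by fun_prop) (by fun_prop)
    · simp only [Set.ofPred_forall]
      exact isClosed_iInter fun j => isClosed_iInter fun _ =>
        isClosed_le (by fun_prop) (by fun_prop)
    all_goals exact isClosed_le (by fun_prop) (by fun_prop)
  refine (isCompact_Icc (a := ((p, 0) : (J → ℝ) × ℝ))
    (b := (fun _ => ∑ i, p i, p k))).of_isClosed_subset hclosed fun x hx => ?_
  exact ⟨⟨InSlice.proc_le hp hx, InSlice.nonneg hx⟩, ⟨InSlice.le_sum hx, InSlice.shift_le hx⟩⟩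

theorem sliceCost_combo [Fintype J] (alpha beta : J → ℝ) (x y : (J → ℝ) × ℝ) {s t : ℝ}
    (hst : s + t = 1) :
    sliceCost p alpha beta T (s • x + t • y)
      = s * sliceCost p alpha beta T x + t * sliceCost p alpha beta T y := by
  have ht : t = 1 - s := by linarith
  subst ht
  simp only [sliceCost, Finset.mul_sum, ← Finset.sum_add_distrib]
  refine Finset.sum_congr rfl fun j _ => ?_
  simp only [Prod.fst_add, Prod.snd_add, Prod.smul_fst, Prod.smul_snd,
      Pi.add_apply, Pi.smul_apply, smul_eq_mul]
  split_ifs <;> ring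

theorem continuous_sliceCost [Fintype J] (alpha beta : J → ℝ) :
    Continuous (sliceCost p alpha beta T) := by
  refine continuous_finsetSum _ fun j _ => ?_
  split_ifs <;> fun_prop

/-- The minimum over a slice is attained at an extreme point. -/
theorem exists_extreme_minimizer [Fintype J] (alpha beta : J → ℝ) (hp : ∀ j, 0 < p j)
    (h : InSlice p d T k x) : ∃ z ∈ (slice p d T k).extremePoints ℝ,
      ∀ y, InSlice p d T k y → sliceCost p alpha beta T z ≤ sliceCost p alpha beta T y := by
  obtain ⟨m, hm, hmin⟩ := (isCompact_slice hp).exists_isMinOn ⟨x, h⟩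
    (continuous_sliceCost (p := p) (T := T) alpha beta).continuousOn
  have hmin' : ∀ y ∈ slice p d T k, sliceCost p alpha beta T m ≤ sliceCost p alpha beta T y := hmin
  have hF : IsCompact (slice p d T k ∩ {y | sliceCost p alpha beta T y
      ≤ sliceCost p alpha beta T m}) :=
    (isCompact_slice hp).inter_right
      (isClosed_le (continuous_sliceCost alpha beta) continuous_const)
  -- The set of minimizers is a nonempty compact face, so it has an extreme point, which is also
  -- extreme in the slice.
  obtain ⟨z, ⟨hz, hzm⟩, hext⟩ := hF.extremePoints_nonempty
      ⟨m, hm, le_refl (sliceCost p alpha beta T m)⟩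
  refine ⟨z, ⟨hz, fun y hy w hw hzyw => ?_⟩, fun y hy => hzm.trans (hmin' y hy)⟩
  obtain ⟨s, t, hs, ht, hst, rfl⟩ := hzyw
  have hzm' : s * sliceCost p alpha beta T y + t * sliceCost p alpha beta T w
      ≤ sliceCost p alpha beta T m := by
    rw [← sliceCost_combo _ _ _ _ hst]
    exact hzm
  have h1 := hmin' y hy
  have h2 := hmin' w hw
  have ht' : t = 1 - s := by linarith
  refine hext ⟨hy, ?_⟩ ⟨hw, ?_⟩ ⟨s, t, hs, ht, hst, rfl⟩
  · change sliceCost p alpha beta T y ≤ _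
    subst ht'
    nlinarith [mul_nonneg ht.le (sub_nonneg.2 h2)]
  · change sliceCost p alpha beta T w ≤ _
    subst ht'
    nlinarith [mul_nonneg hs.le (sub_nonneg.2 h1)]

end Parametrization

-- `x` is the midpoint of `x + ε • v` and `x - ε • v`, both in `V` for small positive `ε`.
open Filter Topology in
theorem eq_zero_of_eventually_add_smul_mem {E : Type*} [AddCommGroup E] [Module ℝ E] {V : Set E}
    {x v : E} (hx : x ∈ V.extremePoints ℝ) (h : ∀ᶠ ε in 𝓝 (0 : ℝ), x + ε • v ∈ V) : v = 0 := by
  have h' : ∀ᶠ ε in 𝓝 (0 : ℝ), x + (-ε) • v ∈ V := by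
    have : Tendsto (fun ε : ℝ => -ε) (𝓝 0) (𝓝 0) := by
      simpa using (continuous_neg (G := ℝ)).tendsto 0
    exact this.eventually h
  obtain ⟨ε, hε, hε0⟩ := ((eventually_nhdsWithin_of_eventually_nhds (h.and h')).and
    (self_mem_nhdsWithin (a := (0 : ℝ)) (s := Set.Ioi 0))).exists
  have h1 := hx.2 hε.1 hε.2 ⟨1 / 2, 1 / 2, by norm_num, by norm_num, by norm_num, by module⟩
  rw [add_eq_left] at h1
  exact (smul_eq_zero.1 h1).resolve_left (ne_of_gt hε0)

/-! ### Extreme minimizers over a slice are compressed on both sides. -/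

section Minimizers

variable {J : Type*} [LinearOrder J] [Fintype J]

/-- The side of the reference point on which `j` is processed. -/
def side (T : Finset J) (j : J) : Finset J := if j ∈ T then T else Tᶜ

/-- The unit penalty of `j`, depending on the side of the reference point. -/
def weight (alpha beta : J → ℝ) (T : Finset J) (j : J) : ℝ := if j ∈ T then beta j else alpha j

/-- The completion times obtained from `C` by compressing both sides of the reference point. -/
noncomputable def compressSides (p : J → ℝ) (T : Finset J) (c : J → ℝ) (j : J) : ℝ :=
  compress p (side T j) c j

variable {p alpha beta : J → ℝ} {d : ℝ} {T : Finset J} {k : J} {x : (J → ℝ) × ℝ}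

theorem mem_side (j : J) : j ∈ side T j := by
  unfold side
  split_ifs with h <;> simp [h]

theorem eq_side {A : Finset J} (hA : A = T ∨ A = Tᶜ) {j : J} (hj : j ∈ A) : side T j = A := by
  unfold side
  rcases hA with rfl | rfl
  · simp [hj]
  · simp [Finset.mem_compl.1 hj]

theorem side_eq_or (j : J) : side T j = T ∨ side T j = Tᶜ := by
  unfold side
  split_ifs <;> simp

theorem InSlice.satisfiesQ (h : InSlice p d T k x) {A : Finset J} (hA : A = T ∨ A = Tᶜ) :
    SatisfiesQ p A x.1 := by
  rcases hA with rfl | rfl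
  · exact h.tardy
  · exact h.early

theorem sliceCost_sub (c c' : J → ℝ) (a : ℝ) :
    sliceCost p alpha beta T (c', a) - sliceCost p alpha beta T (c, a)
      = ∑ j, weight alpha beta T j * (c' j - c j) := by
  rw [sliceCost, sliceCost, ← Finset.sum_sub_distrib]
  refine Finset.sum_congr rfl fun j _ => ?_
  unfold weight
  split_ifs <;> ring

theorem compressSides_eq {A : Finset J} (hA : A = T ∨ A = Tᶜ) {c : J → ℝ} {j : J} (hj : j ∈ A) :
    compressSides p T c j = compress p A c j := by
  rw [compressSides, eq_side hA hj]

theorem NonOverlap.compressSides {A : Finset J} {c : J → ℝ} (hp : ∀ j, 0 < p j)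
    (hA : A = T ∨ A = Tᶜ) (h : NonOverlap p A c) :
    NonOverlap p A (compressSides p T c) :=
  (h.compress hp).congr fun _ hj => compressSides_eq hA hj

theorem NonOverlap.isCompressed_compressSides {A : Finset J} {c : J → ℝ} (hp : ∀ j, 0 < p j)
    (hA : A = T ∨ A = Tᶜ) (h : NonOverlap p A c) :
    IsCompressed p A (CommonDueDate.compressSides p T c) :=
  (h.isCompressed_compress hp).congr fun _ hj => compressSides_eq hA hj

theorem inSlice_compressSides {c : J → ℝ} {a : ℝ} (hp : ∀ j, 0 < p j) (hk : k ∈ T)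
    (hT : NonOverlap p T c) (hE : NonOverlap p Tᶜ c) (hck : compress p T c k ≤ p k)
    (hsum : ∑ j ∈ Tᶜ, p j ≤ d - a) (ha : 0 ≤ a) (hak : a ≤ p k) :
    InSlice p d T k (compressSides p T c, a) where
  mem := hk
  tardy := (hT.compressSides hp (Or.inl rfl)).satisfiesQ hp
  early := (hE.compressSides hp (Or.inr rfl)).satisfiesQ hp
  le_sum j := (compress_le_sum hp j).trans
    (Finset.sum_le_sum_of_subset_of_nonneg (Finset.subset_univ _) fun i _ _ => (hp i).le)
  first_le := by
    change compressSides p T c k ≤ p k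
    rw [compressSides_eq (Or.inl rfl) hk]
    exact hck
  le_sub j hj := by
    change compressSides p T c j ≤ d - a
    rw [compressSides_eq (Or.inr rfl) (Finset.mem_compl.2 hj)]
    exact (compress_le_sum hp j).trans hsum
  sum_le_sub := hsum
  nonneg := ha
  shift_le := hak

/-- In a minimizer, every task of positive weight belongs to a tight set. -/
theorem exists_tight (hx : InSlice p d T k x)
    (hmin : ∀ y, InSlice p d T k y → sliceCost p alpha beta T x ≤ sliceCost p alpha beta T y)
    {j : J} (hj : 0 < weight alpha beta T j) :
    ∃ S ⊆ side T j, ∑ i ∈ S, p i * x.1 i ≤ overlapBound p S ∧ j ∈ S := by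
  -- If no tight set contains `j`, a small decrease of `c j` alone stays in the slice and strictly
  -- lowers the cost.
  by_contra! hne
  have hQ : ∀ A, A = T ∨ A = Tᶜ →
      ∀ᶠ ε in nhds (0 : ℝ), SatisfiesQ p A (x.1 + ε • Pi.single j (-1)) := by
    intro A hA
    refine (hx.satisfiesQ hA).eventually_add_smul _ fun S hS ht => ?_
    refine Finset.sum_eq_zero fun i hi => ?_
    have hij : i ≠ j := by
      rintro rfl
      exact hne S (eq_side hA (hS hi) ▸ hS) ht hi
    simp [hij]
  obtain ⟨ε, hε, hε0⟩ := ((eventually_nhdsWithin_of_eventually_nhds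
    ((hQ T (Or.inl rfl)).and (hQ Tᶜ (Or.inr rfl)))).and
    (self_mem_nhdsWithin (a := (0 : ℝ)) (s := Set.Ioi 0))).exists
  replace hε0 : 0 < ε := hε0
  have hle : ∀ i, (x.1 + ε • Pi.single j (-1) : J → ℝ) i ≤ x.1 i := by
    intro i
    by_cases hij : i = j
    · subst hij
      simp [hε0.le]
    · simp [hij]
  have h1 := hmin (x.1 + ε • Pi.single j (-1), x.2) ⟨hx.mem, hε.1, hε.2,
    fun i => (hle i).trans (hx.le_sum i), (hle k).trans hx.first_le,
    fun i hi => (hle i).trans (hx.le_sub i hi), hx.sum_le_sub, hx.nonneg, hx.shift_le⟩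
  have h2 := sliceCost_sub (p := p) (alpha := alpha) (beta := beta) (T := T) x.1
    (x.1 + ε • Pi.single j (-1)) x.2
  rw [Finset.sum_eq_single j (fun i _ hij => by simp [hij]) (by simp)] at h2
  simp only [Pi.add_apply, Pi.smul_apply, Pi.single_eq_same, smul_eq_mul] at h2
  have h3 := mul_pos hj hε0
  change sliceCost p alpha beta T (x.1, x.2) ≤ _ at h1
  linarith

/-- In an extreme minimizer, tasks of positive weight on the same side do not overlap. -/
theorem nonOverlap_of_extreme (hp : ∀ j, 0 < p j) (hx : x ∈ (slice p d T k).extremePoints ℝ)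
    (hmin : ∀ y, InSlice p d T k y → sliceCost p alpha beta T x ≤ sliceCost p alpha beta T y)
    {i j : J} (hi : 0 < weight alpha beta T i) (hj : 0 < weight alpha beta T j)
    (hside : side T i = side T j) (hij : i ≠ j) :
    x.1 i + p j ≤ x.1 j ∨ x.1 j + p i ≤ x.1 i := by
  have hxs : InSlice p d T k x := hx.1
  by_contra! hno
  obtain ⟨Si, hSi, hti, hiS⟩ := exists_tight hxs hmin hi
  obtain ⟨Sj, hSj, htj, hjS⟩ := exists_tight hxs hmin hj
  have hQi := hxs.satisfiesQ (side_eq_or i)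
  have hQj := hxs.satisfiesQ (side_eq_or j)
  -- A task at or beyond the total of its side would follow all others and could not overlap.
  -- Strictness here keeps the upper bounds on `c i` valid under perturbation.
  have hlti : x.1 i < ∑ l ∈ side T i, p l := by
    by_contra hle
    exact hno.2.not_ge (hQi.add_le_of_sum_le hp hSi hti hiS (not_lt.1 hle)
      (hside ▸ mem_side j) hij.symm)
  have hltj : x.1 j < ∑ l ∈ side T j, p l := by
    by_contra hle
    exact hno.1.not_ge (hQj.add_le_of_sum_le hp hSj htj hjS (not_lt.1 hle)
      (hside ▸ mem_side i) hij)
  have hsep : ∀ A, A = T ∨ A = Tᶜ → ∀ S ⊆ A, ∑ l ∈ S, p l * x.1 l ≤ overlapBound p S →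
      (i ∈ S ↔ j ∈ S) := by
    intro A hA S hS ht
    constructor
    · intro h
      by_contra h'
      exact hno.1.not_ge ((hxs.satisfiesQ hA).add_le_of_tight hp hS ht h
        (by rw [← eq_side hA (hS h), hside]; exact mem_side j) h')
    · intro h
      by_contra h'
      exact hno.2.not_ge ((hxs.satisfiesQ hA).add_le_of_tight hp hS ht h
        (by rw [← eq_side hA (hS h), ← hside]; exact mem_side i) h')
  -- The singleton `{k}` is tight because `c k = p k`. As no tight set separates `i` from `j`,
  -- neither of them is `k`, and the perturbation leaves `c k` fixed.
  have hkt : ∑ l ∈ ({k} : Finset J), p l * x.1 l ≤ overlapBound p {k} := by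
    simp only [Finset.sum_singleton, overlapBound, hxs.first_eq hp]
    linarith
  have hkij : (i = k ↔ j = k) := by
    simpa using hsep T (Or.inl rfl) {k} (by simpa using hxs.mem) hkt
  have hik : i ≠ k := fun h => hij (h.trans (hkij.1 h).symm)
  have hjk : j ≠ k := fun h => hij ((hkij.2 h).trans h.symm)
  -- Scaled so that the `p`-weighted sum of `v` vanishes on any set containing both or neither of
  -- `i` and `j`.
  set v : J → ℝ := Pi.single i (1 / p i) - Pi.single j (1 / p j) with hv
  have hv0 : ∀ l, l ≠ i → l ≠ j → v l = 0 := fun l h1 h2 => by simp [hv, h1, h2]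
  have hvS : ∀ S : Finset J, (i ∈ S ↔ j ∈ S) → ∑ l ∈ S, p l * v l = 0 := by
    intro S hS
    have hs : ∀ m, ∑ l ∈ S, p l * (Pi.single m (1 / p m) : J → ℝ) l
        = if m ∈ S then 1 else 0 := by
      intro m
      simp only [Pi.single_apply, mul_ite, mul_zero, Finset.sum_ite_eq']
      rw [mul_one_div_cancel (hp m).ne']
    simp only [hv, Pi.sub_apply, mul_sub, Finset.sum_sub_distrib, hs, hS, sub_self]
  have hQ : ∀ A, A = T ∨ A = Tᶜ → ∀ᶠ ε in nhds (0 : ℝ), SatisfiesQ p A (x.1 + ε • v) :=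
    fun A hA => (hxs.satisfiesQ hA).eventually_add_smul v fun S hS ht =>
      hvS S (hsep A hA S hS ht)
  have hlt : ∀ l, ∀ M, x.1 l < M → ∀ᶠ ε in nhds (0 : ℝ), (x.1 + ε • v) l ≤ M := by
    intro l M hM
    have hcont : Filter.Tendsto (fun ε : ℝ => (x.1 + ε • v) l) (nhds 0)
        (nhds ((x.1 + (0 : ℝ) • v) l)) := by
      simp only [Pi.add_apply, Pi.smul_apply, smul_eq_mul]
      exact Continuous.tendsto (by fun_prop) 0
    rw [zero_smul, add_zero] at hcont
    exact (hcont.eventually (gt_mem_nhds hM)).mono fun ε hε => hε.le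
  have hside_le : ∀ l, ∑ m ∈ side T l, p m ≤ ∑ m, p m := fun l =>
    Finset.sum_le_sum_of_subset_of_nonneg (Finset.subset_univ _) fun m _ _ => (hp m).le
  have hbound : ∀ l, l ∉ T → ∑ m ∈ side T l, p m ≤ d - x.2 := fun l hl => by
    rw [eq_side (Or.inr rfl) (Finset.mem_compl.2 hl)]
    exact hxs.sum_le_sub
  have hev : ∀ᶠ ε in nhds (0 : ℝ), x + ε • (v, (0 : ℝ)) ∈ slice p d T k := by
    filter_upwards [hQ T (Or.inl rfl), hQ Tᶜ (Or.inr rfl), hlt i _ hlti, hlt j _ hltj]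
      with ε hT hE hεi hεj
    refine ⟨hxs.mem, hT, hE, fun l => ?_, ?_, fun l hl => ?_, ?_, ?_, ?_⟩
    · by_cases hli : l = i
      · subst hli
        exact hεi.trans (hside_le l)
      · by_cases hlj : l = j
        · subst hlj
          exact hεj.trans (hside_le l)
        · simpa [hv0 l hli hlj] using hxs.le_sum l
    · simpa [hv0 k hik.symm hjk.symm] using hxs.first_le
    · have h2 : (x + ε • (v, (0 : ℝ))).2 = x.2 := by simp
      rw [h2]
      by_cases hli : l = i
      · subst hli
        exact hεi.trans (hbound l hl)
      · by_cases hlj : l = j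
        · subst hlj
          exact hεj.trans (hbound l hl)
        · simpa [hv0 l hli hlj] using hxs.le_sub l hl
    · simpa using hxs.sum_le_sub
    · simpa using hxs.nonneg
    · simpa using hxs.shift_le
  have h0 := congrFun (congrArg Prod.fst (eq_zero_of_eventually_add_smul_mem hx hev)) i
  simp [hv, hij] at h0
  exact (hp i).ne' h0

/-- An extreme minimizer is, up to the tasks of weight zero, a pair of compressed schedules. -/
theorem exists_compressed (hp : ∀ j, 0 < p j) (halpha : ∀ j, 0 ≤ alpha j)
    (hbeta : ∀ j, 0 < beta j) (hx : x ∈ (slice p d T k).extremePoints ℝ)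
    (hmin : ∀ y, InSlice p d T k y → sliceCost p alpha beta T x ≤ sliceCost p alpha beta T y) :
    ∃ c, InSlice p d T k (c, x.2) ∧
      (∀ A, A = T ∨ A = Tᶜ → NonOverlap p A c ∧ IsCompressed p A c) ∧
      sliceCost p alpha beta T (c, x.2) = sliceCost p alpha beta T x ∧
      ∀ j, 0 < weight alpha beta T j → c j = x.1 j := by
  have hxs : InSlice p d T k x := hx.1
  have hw : ∀ j, 0 ≤ weight alpha beta T j := fun j => by
    unfold weight
    split_ifs
    · exact (hbeta j).le
    · exact halpha j
  -- Zero-weight tasks are stacked after `p(J)`, beyond all positive-weight tasks, in the order of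
  -- `J`. This removes overlaps at no cost; compression then restores the bounds of the slice.
  set c : J → ℝ := fun j => if 0 < weight alpha beta T j then x.1 j else
    ∑ i, p i + ∑ i with ¬ 0 < weight alpha beta T i ∧ i ≤ j, p i with hc
  have hcpos : ∀ j, 0 < weight alpha beta T j → c j = x.1 j := fun j hj => if_pos hj
  have hczero : ∀ j, ¬ 0 < weight alpha beta T j →
      c j = ∑ i, p i + ∑ i with ¬ 0 < weight alpha beta T i ∧ i ≤ j, p i := fun j hj => if_neg hj
  have hlast : ∀ j, ¬ 0 < weight alpha beta T j → ∑ i, p i + p j ≤ c j := fun j hj => by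
    rw [hczero j hj]
    have hmem : j ∈ ({i | ¬ 0 < weight alpha beta T i ∧ i ≤ j} : Finset J) := by simpa using hj
    linarith [Finset.single_le_sum (f := p) (fun i _ => (hp i).le) hmem]
  have hzero : ∀ i j, ¬ 0 < weight alpha beta T i → ¬ 0 < weight alpha beta T j → i < j →
      c i + p j ≤ c j := by
    intro i j hi hj hij
    rw [hczero i hi, hczero j hj, add_assoc, add_comm _ (p j), ← Finset.sum_insert (by simp [hij])]
    refine add_le_add_right (Finset.sum_le_sum_of_subset_of_nonneg ?_ fun i _ _ => (hp i).le) _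
    intro l hl
    simp only [Finset.mem_insert, Finset.mem_filter, Finset.mem_univ, true_and] at hl ⊢
    rcases hl with rfl | ⟨hl, hl'⟩
    · exact ⟨hj, le_rfl⟩
    · exact ⟨hl, hl'.trans hij.le⟩
  have hno : ∀ A, A = T ∨ A = Tᶜ → NonOverlap p A c := by
    intro A hA
    refine ⟨fun j _ => ?_, fun i hi j hj hij => ?_⟩
    · by_cases hj : 0 < weight alpha beta T j
      · rw [hcpos j hj]
        exact hxs.proc_le hp j
      · linarith [hlast j hj, Finset.sum_nonneg fun i (_ : i ∈ Finset.univ) => (hp i).le]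
    · by_cases hwi : 0 < weight alpha beta T i <;> by_cases hwj : 0 < weight alpha beta T j
      · rw [hcpos i hwi, hcpos j hwj]
        exact nonOverlap_of_extreme hp hx hmin hwi hwj
          ((eq_side hA hi).trans (eq_side hA hj).symm) hij
      · left
        linarith [hlast j hwj, hcpos i hwi, hxs.le_sum i]
      · right
        linarith [hlast i hwi, hcpos j hwj, hxs.le_sum j]
      · rcases lt_or_gt_of_ne hij with h | h
        · exact Or.inl (hzero i j hwi hwj h)
        · exact Or.inr (hzero j i hwj hwi h)
  have hwk : 0 < weight alpha beta T k := by
    rw [weight, if_pos hxs.mem]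
    exact hbeta k
  have hin : InSlice p d T k (compressSides p T c, x.2) :=
    inSlice_compressSides hp hxs.mem (hno T (Or.inl rfl)) (hno _ (Or.inr rfl))
      (((hno T (Or.inl rfl)).compress_le hp hxs.mem).trans (hcpos k hwk ▸ hxs.first_le))
      hxs.sum_le_sub hxs.nonneg hxs.shift_le
  have hle : ∀ j, 0 < weight alpha beta T j → compressSides p T c j ≤ x.1 j := fun j hj =>
    ((hno _ (side_eq_or j)).compress_le hp (mem_side j)).trans (hcpos j hj).le
  have hterm : ∀ j ∈ Finset.univ,
      weight alpha beta T j * (compressSides p T c j - x.1 j) ≤ 0 := by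
    intro j _
    rcases (hw j).eq_or_lt with h | h
    · rw [← h, zero_mul]
    · exact mul_nonpos_of_nonneg_of_nonpos h.le (sub_nonpos.2 (hle j h))
  have hsub := sliceCost_sub (p := p) (alpha := alpha) (beta := beta) (T := T) x.1
    (compressSides p T c) x.2
  have hge : 0 ≤ ∑ j, weight alpha beta T j * (compressSides p T c j - x.1 j) := by
    rw [← hsub]
    exact sub_nonneg.2 (hmin _ hin)
  -- Compression lowers no cost, by minimality, yet each term is nonpositive; so all terms vanish
  -- and positive-weight tasks do not move.
  have hsum := le_antisymm (Finset.sum_nonpos hterm) hge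
  refine ⟨compressSides p T c, hin, fun A hA => ⟨(hno A hA).compressSides hp hA,
    (hno A hA).isCompressed_compressSides hp hA⟩, ?_, fun j hj => ?_⟩
  · rw [hsum] at hsub
    exact sub_eq_zero.1 hsub
  · have h1 := (Finset.sum_eq_zero_iff_of_nonpos hterm).1 hsum j (Finset.mem_univ j)
    linarith [(mul_eq_zero.1 h1).resolve_left hj.ne']

end Minimizers

/-! ### Shifting a schedule and its first late task. -/

section Schedules

variable {J : Type*} {p alpha beta C : J → ℝ} {d : ℝ}

theorem Feasible.shift {s : ℝ} (hC : Feasible p C) (hs : 0 ≤ s) :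
    Feasible p (fun j => C j + s) := by
  refine ⟨fun j => by linarith [hC.1 j], fun i j hij => ?_⟩
  rcases hC.2 i j hij with h | h
  · left; linarith
  · right; linarith

variable [Fintype J]

theorem penalty_shift {M : ℝ} (hM : ∀ j, C j ≤ M) (hMd : M ≤ d) :
    penalty alpha beta d (fun j => C j + (d - M))
      = penalty alpha beta d C - (d - M) * ∑ j, alpha j := by
  rw [penalty, penalty, Finset.mul_sum, ← Finset.sum_sub_distrib]
  refine Finset.sum_congr rfl fun j _ => ?_
  have h := hM j
  rw [max_eq_left (by linarith), max_eq_right (by linarith), max_eq_left (by linarith),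
    max_eq_right (by linarith)]
  ring

/-- The first task among those completing at or after `d`. -/
theorem exists_first_late (hp : ∀ j, 0 < p j) (hC : Feasible p C) (hex : ∃ j, d ≤ C j) :
    ∃ k, d ≤ C k ∧ (∀ j, d ≤ C j → C k - p k ≤ C j - p j) ∧
      ∀ j, C j < d → C j ≤ C k - p k := by
  obtain ⟨k, hk, hmin⟩ := ({j | d ≤ C j} : Finset J).exists_min_image (fun j => C j - p j)
    (by simpa [Finset.Nonempty] using hex)
  simp only [Finset.mem_filter, Finset.mem_univ, true_and] at hk hmin
  refine ⟨k, hk, hmin, fun j hj => ?_⟩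
  have hjk : j ≠ k := by
    rintro rfl
    linarith
  rcases hC.2 j k hjk with h | h
  · linarith
  · linarith [hp j]

end Schedules

/-! ### Passing between slice points and schedules. -/

section Conversion

variable {J : Type*} [LinearOrder J] {p alpha beta C : J → ℝ} {d : ℝ} {T : Finset J} {k : J}
  {x : (J → ℝ) × ℝ}

/-- The completion times described by `(c, a)`. -/
def schedule (p : J → ℝ) (d : ℝ) (T : Finset J) (x : (J → ℝ) × ℝ) (j : J) : ℝ :=
  if j ∈ T then d - x.2 + x.1 j else d - x.2 - (x.1 j - p j)

/-- The vector `c` describing the completion times `C` relative to the reference point `d - a`. -/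
def relTime (p : J → ℝ) (d : ℝ) (T : Finset J) (C : J → ℝ) (a : ℝ) (j : J) : ℝ :=
  if j ∈ T then C j - (d - a) else d - a - C j + p j

theorem schedule_relTime (a : ℝ) : schedule p d T (relTime p d T C a, a) = C := by
  funext j
  simp only [schedule, relTime]
  split_ifs <;> ring

theorem schedule_of_mem {j : J} (hj : j ∈ T) : schedule p d T x j = d - x.2 + x.1 j := if_pos hj

theorem schedule_of_notMem {j : J} (hj : j ∉ T) :
    schedule p d T x j = d - x.2 - (x.1 j - p j) := if_neg hj

variable [Fintype J]

theorem nonOverlap_relTime {a : ℝ} (hC : Feasible p C) (hT : ∀ j ∈ T, d - a ≤ C j - p j)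
    (hE : ∀ j ∉ T, C j ≤ d - a) {A : Finset J} (hA : A = T ∨ A = Tᶜ) :
    NonOverlap p A (relTime p d T C a) := by
  rcases hA with rfl | rfl
  · refine ⟨fun j hj => ?_, fun i hi j hj hij => ?_⟩
    · simp only [relTime, if_pos hj]
      linarith [hT j hj]
    · simp only [relTime, if_pos hi, if_pos hj]
      rcases hC.2 i j hij with h | h
      · left; linarith
      · right; linarith
  · refine ⟨fun j hj => ?_, fun i hi j hj hij => ?_⟩
    · simp only [relTime, if_neg (Finset.mem_compl.1 hj)]
      linarith [hE j (Finset.mem_compl.1 hj)]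
    · simp only [relTime, if_neg (Finset.mem_compl.1 hj), if_neg (Finset.mem_compl.1 hi)]
      rcases hC.2 i j hij with h | h
      · right; linarith
      · left; linarith

theorem sum_compl_le {a : ℝ} (hp : ∀ j, 0 < p j) (hC : Feasible p C) (had : a ≤ d)
    (hT : ∀ j ∈ T, d - a ≤ C j - p j) (hE : ∀ j ∉ T, C j ≤ d - a) :
    ∑ j ∈ Tᶜ, p j ≤ d - a := by
  refine (nonOverlap_relTime hC hT hE (Or.inr rfl)).sum_le hp (sub_nonneg.2 had) fun j hj => ?_
  simp only [relTime, if_neg (Finset.mem_compl.1 hj)]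
  linarith [hC.1 j]

theorem feasible_schedule (hp : ∀ j, 0 < p j) (hx : InSlice p d T k x)
    (hno : ∀ A, A = T ∨ A = Tᶜ → NonOverlap p A x.1) : Feasible p (schedule p d T x) := by
  have had := hx.shift_le_dueDate hp
  have hc := hx.proc_le hp
  have hcross : ∀ i j, i ∈ T → j ∉ T →
      schedule p d T x j + p i ≤ schedule p d T x i := by
    intro i j hi hj
    rw [schedule_of_mem hi, schedule_of_notMem hj]
    linarith [hc i, hc j]
  refine ⟨fun j => ?_, fun i j hij => ?_⟩
  · by_cases hj : j ∈ T
    · rw [schedule_of_mem hj]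
      linarith [hc j]
    · rw [schedule_of_notMem hj]
      linarith [hx.le_sub j hj]
  · by_cases hi : i ∈ T <;> by_cases hj : j ∈ T
    · rw [schedule_of_mem hi, schedule_of_mem hj]
      rcases (hno T (Or.inl rfl)).2 i hi j hj hij with h | h
      · left; linarith
      · right; linarith
    · exact Or.inr (hcross i j hi hj)
    · exact Or.inl (hcross j i hj hi)
    · rw [schedule_of_notMem hi, schedule_of_notMem hj]
      rcases (hno Tᶜ (Or.inr rfl)).2 i (Finset.mem_compl.2 hi) j (Finset.mem_compl.2 hj) hij
        with h | h
      · right; linarith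
      · left; linarith

theorem penalty_schedule (hT : ∀ j ∈ T, d ≤ schedule p d T x j)
    (hE : ∀ j ∉ T, schedule p d T x j ≤ d) :
    penalty alpha beta d (schedule p d T x) = sliceCost p alpha beta T x := by
  refine Finset.sum_congr rfl fun j _ => ?_
  by_cases hj : j ∈ T
  · have h := hT j hj
    rw [max_eq_right (by linarith), max_eq_left (by linarith), if_pos hj, schedule_of_mem hj]
    ring
  · have h := hE j hj
    rw [max_eq_left (by linarith), max_eq_right (by linarith), if_neg hj, schedule_of_notMem hj]
    ring

/-- The first task `k` completes at `d - a + p k`, and `a ≤ p k`; the rest of `T` follows it. This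
is why penalties with respect to `d` are given exactly by the slice cost. -/
theorem dueDate_le_schedule (hp : ∀ j, 0 < p j) (hx : InSlice p d T k x)
    (hno : NonOverlap p T x.1) {j : J} (hj : j ∈ T) : d ≤ schedule p d T x j := by
  rw [schedule_of_mem hj]
  by_cases hjk : j = k
  · subst hjk
    linarith [hx.shift_le, hx.first_eq hp]
  · rcases hno.2 k hx.mem j hj (Ne.symm hjk) with h | h
    · linarith [hx.shift_le, hx.first_eq hp, hp j]
    · linarith [hx.first_eq hp, hx.proc_le hp j, hp j]

theorem schedule_le_reference (hp : ∀ j, 0 < p j) (hx : InSlice p d T k x) {j : J} (hj : j ∉ T) :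
    schedule p d T x j ≤ d - x.2 := by
  rw [schedule_of_notMem hj]
  linarith [hx.proc_le hp j]

theorem penalty_schedule_of_inSlice (hp : ∀ j, 0 < p j) (hx : InSlice p d T k x)
    (hno : NonOverlap p T x.1) :
    penalty alpha beta d (schedule p d T x) = sliceCost p alpha beta T x :=
  penalty_schedule (fun _ hj => dueDate_le_schedule hp hx hno hj) fun _ hj =>
    (schedule_le_reference hp hx hj).trans (sub_le_self d hx.nonneg)

/-- Every vector of a slice costs at least as much as some feasible schedule. -/
theorem exists_feasible_le_sliceCost (hp : ∀ j, 0 < p j) (halpha : ∀ j, 0 ≤ alpha j)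
    (hbeta : ∀ j, 0 < beta j) (hx : InSlice p d T k x) :
    ∃ C, Feasible p C ∧ penalty alpha beta d C ≤ sliceCost p alpha beta T x := by
  obtain ⟨z, hz, hmin⟩ := exists_extreme_minimizer alpha beta hp hx
  obtain ⟨c, hc, hno, hcost, -⟩ := exists_compressed hp halpha hbeta hz hmin
  refine ⟨_, feasible_schedule hp hc fun A hA => (hno A hA).1, ?_⟩
  rw [penalty_schedule_of_inSlice hp hc (hno T (Or.inl rfl)).1, hcost]
  exact hmin x hx

/-- Take `T` to be the tasks completing at or after `d`; then the penalty is the slice cost of the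
relative times, and compressing both sides towards the reference point cannot increase it. -/
theorem exists_inSlice_of_late (hp : ∀ j, 0 < p j) (halpha : ∀ j, 0 ≤ alpha j)
    (hbeta : ∀ j, 0 < beta j) (hd : 0 ≤ d) (hC : Feasible p C) (hex : ∃ j, d ≤ C j) :
    ∃ T k x, InSlice p d T k x ∧ sliceCost p alpha beta T x ≤ penalty alpha beta d C := by
  obtain ⟨k, hk, hfirst, hearly⟩ := exists_first_late hp hC hex
  set T : Finset J := {j | d ≤ C j} with hTdef
  have hmem : ∀ j, j ∈ T ↔ d ≤ C j := fun j => by simp [hTdef]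
  -- The reference point is the start of the first late task, or `d` if that task starts after `d`;
  -- the minimum ensures `0 ≤ a`.
  set a := d - min d (C k - p k) with ha
  have hda : d - a = min d (C k - p k) := by rw [ha]; ring
  have had : a ≤ d := by
    have := hC.1 k
    linarith [le_min hd (sub_nonneg.2 this)]
  have hT : ∀ j ∈ T, d - a ≤ C j - p j := fun j hj =>
    hda.le.trans ((min_le_right _ _).trans (hfirst j ((hmem j).1 hj)))
  have hE : ∀ j ∉ T, C j ≤ d - a := fun j hj => by
    have hj' : C j < d := not_le.1 fun h => hj ((hmem j).2 h)
    rw [hda]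
    exact le_min hj'.le (hearly j hj')
  have hkT := (hmem k).2 hk
  have hno := fun A hA => nonOverlap_relTime (A := A) hC hT hE hA
  have hck : compress p T (relTime p d T C a) k ≤ p k := by
    have hsub : T.filter (fun i => relTime p d T C a i ≤ relTime p d T C a k) ⊆ {k} := by
      intro i hi
      rw [Finset.mem_filter] at hi
      by_contra hik
      rw [Finset.mem_singleton] at hik
      have h1 := (hno T (Or.inl rfl)).add_le hp hi.1 hkT hik hi.2
      simp only [relTime, if_pos hi.1, if_pos hkT] at h1
      linarith [hfirst i ((hmem i).1 hi.1), hp i]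
    exact (Finset.sum_le_sum_of_subset_of_nonneg hsub fun i _ _ => (hp i).le).trans
      (Finset.sum_singleton p k).le
  refine ⟨T, k, (compressSides p T (relTime p d T C a), a), inSlice_compressSides hp hkT
    (hno T (Or.inl rfl)) (hno Tᶜ (Or.inr rfl)) hck (sum_compl_le hp hC had hT hE) ?_ ?_, ?_⟩
  · rw [ha]
    linarith [min_le_left d (C k - p k)]
  · rw [ha, sub_le_comm]
    exact le_min (by linarith [hp k]) (by linarith)
  · have hpen : penalty alpha beta d C
        = sliceCost p alpha beta T (relTime p d T C a, a) := by
      have := penalty_schedule (p := p) (alpha := alpha) (beta := beta) (T := T) (d := d)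
        (x := (relTime p d T C a, a)) (by
          rw [schedule_relTime]
          exact fun j hj => (hmem j).1 hj) (by
          rw [schedule_relTime]
          exact fun j hj => (not_le.1 fun h => hj ((hmem j).2 h)).le)
      rwa [schedule_relTime] at this
    rw [hpen, ← sub_nonpos, sliceCost_sub]
    refine Finset.sum_nonpos fun j _ => mul_nonpos_of_nonneg_of_nonpos ?_ (sub_nonpos.2
      ((hno _ (side_eq_or j)).compress_le hp (mem_side j)))
    unfold weight
    split_ifs
    · exact (hbeta j).le
    · exact halpha j

/-- Every feasible schedule costs at least as much as some vector of a slice. -/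
theorem exists_inSlice_le_penalty [Nonempty J] (hp : ∀ j, 0 < p j) (halpha : ∀ j, 0 ≤ alpha j)
    (hbeta : ∀ j, 0 < beta j) (hd : 0 ≤ d) (hC : Feasible p C) :
    ∃ T k x, InSlice p d T k x ∧ sliceCost p alpha beta T x ≤ penalty alpha beta d C := by
  obtain ⟨m, hm⟩ := Finite.exists_max C
  rcases le_total d (C m) with h | h
  · exact exists_inSlice_of_late hp halpha hbeta hd hC ⟨m, h⟩
  · obtain ⟨T, k, x, hx, hcost⟩ := exists_inSlice_of_late hp halpha hbeta hd
      (hC.shift (sub_nonneg.2 h)) ⟨m, by linarith⟩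
    refine ⟨T, k, x, hx, hcost.trans ?_⟩
    rw [penalty_shift hm h]
    have := mul_nonneg (sub_nonneg.2 h) (Finset.sum_nonneg fun j (_ : j ∈ Finset.univ) => halpha j)
    linarith

theorem encodesWith_schedule (hp : ∀ j, 0 < p j) (hx : InSlice p d T k x) {S : Set J}
    (hS : ∀ j, j ∈ S ↔ j ∈ T) :
    EncodesWith p d (schedule p d T x) S (integerPoint p T k x) := by
  have hc := hx.proc_le hp
  have hshift : shift (integerPoint p T k x) = x.2 := rfl
  refine ⟨⟨⟨k, (hS k).2 hx.mem, ?_⟩, ?_⟩, fun j => ?_, fun j => ?_, fun j => ⟨?_, ?_⟩⟩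
  · simp only [schedule_of_mem hx.mem, hx.first_eq hp, hshift]
    ring
  · rintro _ ⟨j, hj, rfl⟩
    simp only [schedule_of_mem ((hS j).1 hj), hshift]
    linarith [hc j]
  · rw [hshift]
    simp only [early, integerPoint, schedule]
    split_ifs
    · rw [max_eq_right (by linarith [hc j, hp j])]
    · rw [max_eq_left (by linarith [hc j])]
      ring
  · rw [hshift]
    simp only [tardy, integerPoint, schedule]
    split_ifs
    · rw [max_eq_left (by linarith [hc j, hp j])]
      ring
    · rw [max_eq_right (by linarith [hc j])]
  · intro hj
    simp [prodv, integerPoint, (hS j).1 hj]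
  · intro hj
    rw [hshift]
    simp [prodv, integerPoint, mt (hS j).2 hj]

theorem noIdle_schedule (hp : ∀ j, 0 < p j) (hx : InSlice p d T k x)
    (hno : ∀ A, A = T ∨ A = Tᶜ → NonOverlap p A x.1 ∧ IsCompressed p A x.1) :
    NoIdle p (schedule p d T x) := by
  have hc := hx.proc_le hp
  rintro s ⟨i, hi⟩ ⟨l, hl⟩
  rcases le_or_gt (d - x.2) s with hs | hs
  · have hlT : l ∈ T := by
      by_contra h
      linarith [schedule_le_reference hp hx h]
    rw [schedule_of_mem hlT] at hl
    obtain ⟨j, hj, h1, h2⟩ := (hno T (Or.inl rfl)).2.exists_busy hp (hno T (Or.inl rfl)).1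
      (u := s - (d - x.2)) (by linarith) ⟨l, hlT, by linarith⟩
    refine ⟨j, ?_⟩
    rw [schedule_of_mem hj]
    exact ⟨by linarith, by linarith⟩
  · have hiT : i ∉ T := by
      intro h
      rw [schedule_of_mem h] at hi
      linarith [hc i]
    rw [schedule_of_notMem hiT] at hi
    obtain ⟨j, hj, h1, h2⟩ := (hno Tᶜ (Or.inr rfl)).2.exists_busy' hp (hno Tᶜ (Or.inr rfl)).1
      (u := d - x.2 - s) (by linarith) ⟨i, Finset.mem_compl.2 hiT, by linarith⟩
    refine ⟨j, ?_⟩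
    rw [schedule_of_notMem (Finset.mem_compl.1 hj)]
    exact ⟨by linarith, by linarith⟩

/-- At an extreme point, the reference point cannot be moved in both directions. -/
theorem shift_cases (hx : x ∈ (slice p d T k).extremePoints ℝ)
    (hc : ∀ j ∉ T, x.1 j ≤ ∑ i ∈ Tᶜ, p i) :
    x.2 = 0 ∨ x.2 = p k ∨ ∑ j ∈ Tᶜ, p j = d - x.2 := by
  have hxs : InSlice p d T k x := hx.1
  by_contra! hne
  have h1 := lt_of_le_of_ne hxs.nonneg hne.1.symm
  have h2 := lt_of_le_of_ne hxs.shift_le hne.2.1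
  have h3 := lt_of_le_of_ne hxs.sum_le_sub hne.2.2
  have hcont : Filter.Tendsto (fun ε : ℝ => x.2 + ε) (nhds 0) (nhds x.2) := by
    simpa using (continuous_const_add x.2).tendsto (0 : ℝ)
  -- With all three bounds on `a` strict, `a` alone can move in either direction; `hc` takes care of
  -- the bounds on individual early tasks.
  have hev : ∀ᶠ ε in nhds (0 : ℝ), x + ε • ((0 : J → ℝ), (1 : ℝ)) ∈ slice p d T k := by
    filter_upwards [hcont.eventually (lt_mem_nhds h1), hcont.eventually (gt_mem_nhds h2),
      hcont.eventually (gt_mem_nhds (lt_sub_comm.1 h3))] with ε hε1 hε2 hε3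
    have hxε : x + ε • ((0 : J → ℝ), (1 : ℝ)) = (x.1, x.2 + ε) := by
      ext <;> simp
    rw [hxε]
    exact ⟨hxs.mem, hxs.tardy, hxs.early, hxs.le_sum, hxs.first_le,
      fun j hj => (hc j hj).trans (by linarith), by linarith, hε1.le, hε2.le⟩
  simpa using congrArg Prod.snd (eq_zero_of_eventually_add_smul_mem hx hev)

/-- Compressed schedules on both sides whose shift is extremal are extreme points. -/
theorem mem_extremePoints_slice (hp : ∀ j, 0 < p j) (hx : InSlice p d T k x)
    (hno : ∀ A, A = T ∨ A = Tᶜ → NonOverlap p A x.1 ∧ IsCompressed p A x.1)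
    (ha : x.2 = p k ∨ d - x.2 ≤ ∑ j ∈ Tᶜ, p j) : x ∈ (slice p d T k).extremePoints ℝ := by
  refine ⟨hx, fun y hy z hz hyz => ?_⟩
  obtain ⟨s, t, hs, ht, hst, rfl⟩ := hyz
  replace hy : InSlice p d T k y := hy
  replace hz : InSlice p d T k z := hz
  refine Prod.ext (funext fun j => ?_) ?_
  · have hA := side_eq_or (T := T) j
    exact (hno _ hA).2.eq_of_combo hp (hno _ hA).1 hs ht hst (hy.satisfiesQ hA)
      (hz.satisfiesQ hA) (fun j _ => rfl) j (mem_side j)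
  · simp only [Prod.snd_add, Prod.smul_snd, smul_eq_mul] at ha ⊢
    have ht' : t = 1 - s := by linarith
    subst ht'
    have hys := hy.shift_le
    have hzs := hz.shift_le
    have hyd := hy.sum_le_sub
    have hzd := hz.sum_le_sub
    -- In either case `a` attains an upper bound that `y.2` and `z.2` also obey, so both equal it.
    rcases ha with ha | ha
    · have h1 := mul_nonneg hs.le (sub_nonneg.2 hys)
      have h2 := mul_nonneg ht.le (sub_nonneg.2 hzs)
      have h3 : s * (p k - y.2) = 0 := by linarith
      rw [ha]
      linarith [(mul_eq_zero.1 h3).resolve_left hs.ne']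
    · have h1 := mul_nonneg hs.le (sub_nonneg.2 hyd)
      have h2 := mul_nonneg ht.le (sub_nonneg.2 hzd)
      have h3 : s * (d - y.2 - ∑ j ∈ Tᶜ, p j) = 0 := by linarith
      have h4 : (1 - s) * (d - z.2 - ∑ j ∈ Tᶜ, p j) = 0 := by linarith
      have h5 := (mul_eq_zero.1 h3).resolve_left hs.ne'
      have h6 := (mul_eq_zero.1 h4).resolve_left ht.ne'
      linear_combination (1 - s) * (h6 - h5)

end Conversion

/-! ### Equality of the two minima and the three correspondences. -/

section Main

variable {J : Type*} [LinearOrder J] [Fintype J] {p alpha beta C : J → ℝ} {d : ℝ} {T : Finset J}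
  {k : J} {x : (J → ℝ) × ℝ}

theorem integerPoint_mem_intPoints (hp : ∀ j, 0 < p j)
    (hx : x ∈ (slice p d T k).extremePoints ℝ) :
    integerPoint p T k x ∈ intPoints ((P3 p d).extremePoints ℝ) := by
  refine ⟨(integerPoint_mem_extremePoints_iff hp).2 hx, fun j => ?_, fun j => ?_⟩
  · simp only [delta, integerPoint]
    split_ifs <;> simp
  · simp only [gam, integerPoint]
    split_ifs <;> simp

/-- Every slice attains its minimum at an extreme point, which is a competitor in `P3`; hence
minimality among integer extreme points extends to all points of all slices. -/
theorem IsF3Minimizer.exists_integerPoint (hp : ∀ j, 0 < p j) {X : Point J}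
    (hX : IsF3Minimizer p alpha beta d X) :
    ∃ T k x, X = integerPoint p T k x ∧ x ∈ (slice p d T k).extremePoints ℝ ∧
      ∀ T' k' y, InSlice p d T' k' y →
        sliceCost p alpha beta T x ≤ sliceCost p alpha beta T' y := by
  obtain ⟨⟨hext, hδ, hγ⟩, hmin⟩ := hX
  obtain ⟨T, k, x, rfl, -⟩ := CommonDueDate.exists_integerPoint hext.1 hδ hγ
  refine ⟨T, k, x, rfl, (integerPoint_mem_extremePoints_iff hp).1 hext, fun T' k' y hy => ?_⟩
  obtain ⟨z, hz, hzmin⟩ := exists_extreme_minimizer alpha beta hp hy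
  have h : objective alpha beta (integerPoint p T k x)
      ≤ objective alpha beta (integerPoint p T' k' z) := hmin (integerPoint_mem_intPoints hp hz)
  rw [objective_integerPoint, objective_integerPoint] at h
  exact h.trans (hzmin y hy)

theorem isF3Minimizer_of_isOptimal (hp : ∀ j, 0 < p j) (halpha : ∀ j, 0 ≤ alpha j)
    (hbeta : ∀ j, 0 < beta j) (hx : x ∈ (slice p d T k).extremePoints ℝ)
    (hC : IsOptimal p alpha beta d C)
    (hcost : sliceCost p alpha beta T x ≤ penalty alpha beta d C) :
    IsF3Minimizer p alpha beta d (integerPoint p T k x) := by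
  refine ⟨integerPoint_mem_intPoints hp hx, fun Y hY => ?_⟩
  obtain ⟨T', k', y, rfl, hy⟩ := exists_integerPoint hY.1.1 hY.2.1 hY.2.2
  obtain ⟨C', hC', hle⟩ := exists_feasible_le_sliceCost hp halpha hbeta hy
  change objective alpha beta (integerPoint p T k x)
    ≤ objective alpha beta (integerPoint p T' k' y)
  rw [objective_integerPoint, objective_integerPoint]
  exact hcost.trans ((hC.2 C' hC').trans hle)

theorem isOptimal_schedule [Nonempty J] (hp : ∀ j, 0 < p j) (halpha : ∀ j, 0 ≤ alpha j)
    (hbeta : ∀ j, 0 < beta j) (hd : 0 ≤ d) (hx : InSlice p d T k x)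
    (hno : ∀ A, A = T ∨ A = Tᶜ → NonOverlap p A x.1)
    (hmin : ∀ T' k' y, InSlice p d T' k' y →
      sliceCost p alpha beta T x ≤ sliceCost p alpha beta T' y) :
    IsOptimal p alpha beta d (schedule p d T x) := by
  refine ⟨feasible_schedule hp hx hno, fun C' hC' => ?_⟩
  obtain ⟨T', k', y, hy, hle⟩ := exists_inSlice_le_penalty hp halpha hbeta hd hC'
  rw [penalty_schedule_of_inSlice hp hx (hno T (Or.inl rfl))]
  exact (hmin T' k' y hy).trans hle

/-- As `beta` is positive, the tasks of weight zero are exactly those with `δ_j = 1` and `alpha j =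
0`, and only these may be moved by `exists_compressed`. -/
theorem IsF3Minimizer.exists_isOptimal [Nonempty J] (hp : ∀ j, 0 < p j)
    (halpha : ∀ j, 0 ≤ alpha j) (hbeta : ∀ j, 0 < beta j) (hd : 0 ≤ d) {X : Point J}
    (hX : IsF3Minimizer p alpha beta d X) :
    ∃ C : J → ℝ, IsOptimal p alpha beta d C ∧
      ∀ j, ((delta X j = 1 ∧ alpha j = 0) → C j ≤ d - shift X) ∧
        (¬ (delta X j = 1 ∧ alpha j = 0) → C j = d - shift X - early X j + tardy X j) := by
  obtain ⟨T, k, x, rfl, hx, hmin⟩ := hX.exists_integerPoint hp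
  obtain ⟨c, hc, hno, hcost, hpos⟩ := exists_compressed hp halpha hbeta hx (hmin T k)
  refine ⟨schedule p d T (c, x.2), isOptimal_schedule hp halpha hbeta hd hc
    (fun A hA => (hno A hA).1) (fun T' k' y hy => hcost.le.trans (hmin T' k' y hy)),
    fun j => ⟨?_, fun hj => ?_⟩⟩
  · rintro ⟨hδ, -⟩
    have hjT : j ∉ T := by
      intro h
      simp [delta, integerPoint, h] at hδ
    exact schedule_le_reference hp hc hjT
  · by_cases hjT : j ∈ T
    · have h1 := hpos j (by rw [weight, if_pos hjT]; exact hbeta j)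
      rw [schedule_of_mem hjT]
      simp [shift, early, tardy, integerPoint, hjT, h1]
    · have hα : alpha j ≠ 0 := fun h => hj ⟨by simp [delta, integerPoint, hjT], h⟩
      have h1 := hpos j (by
        rw [weight, if_neg hjT]
        exact lt_of_le_of_ne (halpha j) hα.symm)
      rw [schedule_of_notMem hjT]
      simp [shift, early, tardy, integerPoint, hjT, h1]

theorem IsF3Minimizer.exists_encodes [Nonempty J] (hp : ∀ j, 0 < p j)
    (halpha : ∀ j, 0 < alpha j) (hbeta : ∀ j, 0 < beta j) (hd : 0 ≤ d) {X : Point J}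
    (hX : IsF3Minimizer p alpha beta d X) :
    ∃ C : J → ℝ, Encodes p d C X ∧ IsDOrLeftBlock p d C ∧ IsOptimal p alpha beta d C := by
  obtain ⟨T, k, ⟨c, a⟩, rfl, hx, hmin⟩ := hX.exists_integerPoint hp
  obtain ⟨c', hc, hno, -, hpos⟩ :=
    exists_compressed hp (fun j => (halpha j).le) hbeta hx (hmin T k)
  obtain rfl : c' = c := funext fun j => hpos j (by
    unfold weight
    split_ifs
    · exact hbeta j
    · exact halpha j)
  have hno' := fun A hA => (hno A hA).1
  have hlate : ∀ j ∈ T, d ≤ schedule p d T (c', a) j := fun j hj =>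
    dueDate_le_schedule hp hc (hno' T (Or.inl rfl)) hj
  have hearly : ∀ j ∉ T, schedule p d T (c', a) j ≤ d - a := fun j hj =>
    schedule_le_reference hp hc hj
  have ha : 0 ≤ a := hc.nonneg
  have hopt := isOptimal_schedule hp (fun j => (halpha j).le) hbeta hd hc hno' hmin
  have hk : schedule p d T (c', a) k = d - a + p k := by
    rw [schedule_of_mem hc.mem, hc.first_eq hp]
  refine ⟨schedule p d T (c', a), ?_, ⟨⟨hopt.1, noIdle_schedule hp hc hno⟩, ?_⟩, hopt⟩
  -- If `a = 0`, early tasks may complete at `d` while those of `T` start at or after `d`, so `T` is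
  -- given by the strict inequality. If `a > 0`, early tasks complete before `d` and a task of `T`
  -- may complete at `d`, so the weak one is right.
  · rcases ha.eq_or_lt with ha0 | ha0
    · refine Or.inl (encodesWith_schedule hp hc fun j => ⟨fun h => ?_, fun h => ?_⟩)
      · by_contra hj
        exact (hearly j hj).not_gt (by simpa [← ha0] using h)
      · change d < schedule p d T (c', a) j
        rw [schedule_of_mem h]
        have h1 : p j ≤ c' j := hc.proc_le hp j
        change d < d - a + c' j
        linarith [hp j]
    · refine Or.inr (encodesWith_schedule hp hc fun j => ⟨fun h => ?_, hlate j⟩)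
      by_contra hj
      have h1 : d ≤ schedule p d T (c', a) j := h
      linarith [hearly j hj]
  · rcases shift_cases hx fun j hj =>
      (hno _ (Or.inr rfl)).2.le_sum hp (Finset.mem_compl.2 hj) with h | h | h
    · obtain rfl : a = 0 := h
      -- With `a = 0`, the last early task completes at `d`. If there is none and `d > 0`, raising
      -- `a` to `min (p k) d` would strictly lower every tardiness, contradicting minimality.
      rcases (Tᶜ).eq_empty_or_nonempty with hE | ⟨i, hi⟩
      · rcases hd.eq_or_lt with hd0 | hd0
        · right
          refine ⟨k, ?_⟩
          rw [hk, ← hd0]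
          ring
        · have hm : 0 < min (p k) d := lt_min (hp k) hd0
          have hnot : ∀ j, j ∈ T := fun j => by
            by_contra hj
            exact Finset.notMem_empty j (hE ▸ Finset.mem_compl.2 hj)
          have h1 := hmin T k (c', min (p k) d) ⟨hc.mem, hc.tardy, hc.early, hc.le_sum,
            hc.first_le, fun j hj => absurd (hnot j) hj,
            by rw [hE, Finset.sum_empty]; exact sub_nonneg.2 (min_le_right _ _), hm.le,
            min_le_left _ _⟩
          have h2 : sliceCost p alpha beta T (c', min (p k) d)
              < sliceCost p alpha beta T (c', 0) := by
            refine Finset.sum_lt_sum_of_nonempty Finset.univ_nonempty fun j _ => ?_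
            rw [if_pos (hnot j), if_pos (hnot j)]
            exact mul_lt_mul_of_pos_left (sub_lt_sub_left hm _) (hbeta j)
          exact absurd h1 h2.not_ge
      · left
        obtain ⟨j, hj, h1, -⟩ := (hno _ (Or.inr rfl)).2.exists_busy hp (hno _ (Or.inr rfl)).1
          (le_refl 0) ⟨i, hi, (hp i).trans_le (hc.proc_le hp i)⟩
        refine ⟨j, ?_⟩
        rw [schedule_of_notMem (Finset.mem_compl.1 hj)]
        have h2 : p j ≤ c' j := hc.proc_le hp j
        change d - 0 - (c' j - p j) = d
        linarith
    · left
      refine ⟨k, ?_⟩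
      rw [hk]
      change a = p k at h
      linarith
    · right
      change _ = d - a at h
      rcases (Tᶜ).eq_empty_or_nonempty with hE | hE
      · rw [hE, Finset.sum_empty] at h
        refine ⟨k, ?_⟩
        rw [hk]
        linarith
      -- The early tasks fill `[0, d - a]`, so the one farthest from the reference point starts at
      -- `0`.
      · obtain ⟨j, hj, hmax⟩ := (Tᶜ).exists_max_image c' hE
        refine ⟨j, ?_⟩
        rw [schedule_of_notMem (Finset.mem_compl.1 hj)]
        have h1 := (hno _ (Or.inr rfl)).2 j hj
        rw [Finset.filter_true_of_mem hmax, h] at h1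
        change d - a - (c' j - p j) - p j = 0
        change c' j = d - a at h1
        linarith

/-- An optimal schedule starting at time `0` has a task completing at or after `d`. -/
theorem exists_late [Nonempty J] (hp : ∀ j, 0 < p j) (halpha : ∀ j, 0 ≤ alpha j)
    (hyp : d ≤ ∑ j, p j ∨ ∃ j, 0 < alpha j) (hC : IsOptimal p alpha beta d C) :
    ∃ j, d ≤ C j := by
  by_contra! hlt
  obtain ⟨m, hm⟩ := Finite.exists_max C
  rcases hyp with hyp | ⟨i, hi⟩
  · have hno : NonOverlap p Finset.univ C :=
      ⟨fun j _ => hC.1.1 j, fun i _ j _ hij => hC.1.2 i j hij⟩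
    linarith [hlt m, hno.sum_le hp ((hp m).le.trans (hC.1.1 m)) fun j _ => hm j]
  · have h1 := hC.2 _ (hC.1.shift (sub_pos.2 (hlt m)).le)
    rw [penalty_shift hm (hlt m).le] at h1
    have h2 : 0 < ∑ j, alpha j := Finset.sum_pos' (fun j _ => halpha j) ⟨i, Finset.mem_univ i, hi⟩
    linarith [mul_pos (sub_pos.2 (hlt m)) h2]

/-- In a block, the tasks on each side of the reference point are compressed. -/
theorem isCompressed_relTime {a : ℝ} (hp : ∀ j, 0 < p j) (hC : IsBlock p C)
    (hT : ∀ j ∈ T, d - a ≤ C j - p j) (hE : ∀ j ∉ T, C j ≤ d - a) (hkT : k ∈ T)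
    (hk : C k - p k = d - a) {A : Finset J} (hA : A = T ∨ A = Tᶜ) :
    IsCompressed p A (relTime p d T C a) := by
  have hno := nonOverlap_relTime hC.1 hT hE hA
  intro j hj
  -- Absence of idle time covers `(0, c j)` by processing intervals; by `key` the task found at `u`
  -- completes no later than `j` in relative time, so it is counted in the sum.
  refine le_antisymm (le_sum_of_cover (c := relTime p d T C a) hp fun u hu huj => ?_)
      (hno.compress_le hp hj)
  have key : ∀ i ∈ A, relTime p d T C a i - p i ≤ u →
      relTime p d T C a i ≤ relTime p d T C a j := by
    intro i hi hiu
    by_contra hlt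
    have hij : j ≠ i := by
      rintro rfl
      exact hlt le_rfl
    linarith [hno.add_le hp hj hi hij (not_le.1 hlt).le]
  rcases hA with rfl | rfl
  · have hrj : relTime p d A C a j = C j - (d - a) := if_pos hj
    obtain ⟨i, hi1, hi2⟩ := hC.2 (d - a + u) ⟨k, by linarith⟩ ⟨j, by linarith⟩
    have hiT : i ∈ A := by
      by_contra h
      linarith [hE i h]
    have hri : relTime p d A C a i = C i - (d - a) := if_pos hiT
    exact ⟨i, Finset.mem_filter.2 ⟨hiT, key i hiT (by linarith)⟩, by linarith, by linarith⟩
  · have hrj : relTime p d T C a j = d - a - C j + p j := if_neg (Finset.mem_compl.1 hj)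
    obtain ⟨i, hi1, hi2⟩ := hC.2 (d - a - u) ⟨j, by linarith⟩ ⟨k, by linarith [hp k]⟩
    have hiT : i ∉ T := by
      intro h
      linarith [hT i h]
    have hri : relTime p d T C a i = d - a - C i + p i := if_neg hiT
    have hiT' := Finset.mem_compl.2 hiT
    exact ⟨i, Finset.mem_filter.2 ⟨hiT', key i hiT' (by linarith)⟩, by linarith, by linarith⟩

theorem IsDOrLeftBlock.exists_isF3Minimizer [Nonempty J] (hp : ∀ j, 0 < p j)
    (halpha : ∀ j, 0 ≤ alpha j) (hbeta : ∀ j, 0 < beta j) (hd : 0 ≤ d)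
    (hyp : d ≤ ∑ j, p j ∨ ∃ j, 0 < alpha j) (hC : IsDOrLeftBlock p d C)
    (hopt : IsOptimal p alpha beta d C) :
    ∃ X : Point J, IsF3Minimizer p alpha beta d X ∧ Encodes p d C X := by
  obtain ⟨k, hk, hfirst, hearly⟩ := exists_first_late hp hopt.1 (exists_late hp halpha hyp hopt)
  -- This gives `0 ≤ a`. In a block starting at `0` with `C k > d`, some task is in process at time
  -- `d`; it completes late, and `k` starts no later than it.
  have hkd : C k - p k ≤ d := by
    rcases hC.2 with ⟨j, hj⟩ | ⟨j, hj⟩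
    · linarith [hfirst j hj.ge, hp j]
    · rcases hk.eq_or_lt with hk' | hk'
      · linarith [hp k]
      · obtain ⟨i, hi1, hi2⟩ := hC.1.2 d ⟨j, by linarith⟩ ⟨k, hk'⟩
        linarith [hfirst i hi2.le]
  set T : Finset J := {j | d ≤ C j} with hTdef
  have hmem : ∀ j, j ∈ T ↔ d ≤ C j := fun j => by simp [hTdef]
  obtain ⟨a, ha⟩ : ∃ a, d - a = C k - p k := ⟨d - (C k - p k), by ring⟩
  have hT : ∀ j ∈ T, d - a ≤ C j - p j := fun j hj => ha.le.trans (hfirst j ((hmem j).1 hj))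
  have hE : ∀ j ∉ T, C j ≤ d - a := fun j hj =>
    (hearly j (not_le.1 fun h => hj ((hmem j).2 h))).trans ha.ge
  have hkT := (hmem k).2 hk
  have had : a ≤ d := by linarith [hopt.1.1 k]
  have hno : ∀ A, A = T ∨ A = Tᶜ → NonOverlap p A (relTime p d T C a) ∧
      IsCompressed p A (relTime p d T C a) := fun A hA =>
    ⟨nonOverlap_relTime hopt.1 hT hE hA, isCompressed_relTime hp hC.1 hT hE hkT ha.symm hA⟩
  have hx : InSlice p d T k (relTime p d T C a, a) := by
    have hcomp : compressSides p T (relTime p d T C a) = relTime p d T C a :=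
      funext fun j => ((hno _ (side_eq_or j)).2 j (mem_side j)).symm
    have h := inSlice_compressSides (p := p) (d := d) (c := relTime p d T C a) (a := a) hp hkT
      (hno T (Or.inl rfl)).1
      (hno _ (Or.inr rfl)).1
      (by
        have h1 := (hno T (Or.inl rfl)).1.compress_le hp hkT
        rw [relTime, if_pos hkT] at h1
        linarith) (sum_compl_le hp hopt.1 had hT hE) (by linarith) (by linarith)
    rwa [hcomp] at h
  have hext : (relTime p d T C a, a) ∈ (slice p d T k).extremePoints ℝ := by
    refine mem_extremePoints_slice hp hx hno ?_
    change a = p k ∨ d - a ≤ _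
    -- An on-time task must be the first late task `k`, whence `a = p k`. A task starting at `0`
    -- forces the early tasks to fill the whole of `[0, d - a]`.
    rcases hC.2 with ⟨j, hj⟩ | ⟨j, hj⟩
    · left
      by_cases hjk : j = k
      · subst hjk
        linarith
      · rcases hopt.1.2 j k hjk with h | h
        · linarith [hfirst j hj.ge, hp j]
        · linarith [hp j]
    · right
      by_cases hjT : j ∈ T
      · linarith [hT j hjT, Finset.sum_nonneg fun i (_ : i ∈ Tᶜ) => (hp i).le]
      · have h1 := (hno _ (Or.inr rfl)).2.le_sum hp (Finset.mem_compl.2 hjT)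
        rw [relTime, if_neg hjT] at h1
        linarith
  have hcost : sliceCost p alpha beta T (relTime p d T C a, a) = penalty alpha beta d C := by
    rw [← penalty_schedule_of_inSlice hp hx (hno T (Or.inl rfl)).1, schedule_relTime]
  refine ⟨integerPoint p T k (relTime p d T C a, a),
    isF3Minimizer_of_isOptimal hp halpha hbeta hext hopt hcost.le, Or.inr ?_⟩
  have h := encodesWith_schedule hp hx (S := {j | d ≤ C j}) fun j => (hmem j).symm
  rwa [schedule_relTime] at h

end Main

end CommonDueDate

theorem theorem24 {J : Type*} [Fintype J] [LinearOrder J] [Nonempty J]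
    (p alpha beta : J → ℝ) (d : ℝ) (hd : 0 ≤ d)
    (hp : ∀ j, 0 < p j) (halpha : ∀ j, 0 ≤ alpha j) (hbeta : ∀ j, 0 < beta j) :
    -- every optimal `d`-or-left-block is encoded by a minimizer
    ((d ≤ ∑ j, p j ∨ ∃ j, 0 < alpha j) →
      ∀ C : J → ℝ, CommonDueDate.IsDOrLeftBlock p d C →
        CommonDueDate.IsOptimal p alpha beta d C →
        ∃ X : CommonDueDate.Point J, CommonDueDate.IsF3Minimizer p alpha beta d X ∧
          CommonDueDate.Encodes p d C X) ∧
    -- for positive earliness penalties, every minimizer encodes an optimal `d`-or-left-block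
    ((∀ j, 0 < alpha j) →
      ∀ X : CommonDueDate.Point J, CommonDueDate.IsF3Minimizer p alpha beta d X →
        ∃ C : J → ℝ, CommonDueDate.Encodes p d C X ∧
          CommonDueDate.IsDOrLeftBlock p d C ∧ CommonDueDate.IsOptimal p alpha beta d C) ∧
    -- in general, every minimizer encodes an optimal schedule up to the placement of the tasks
    -- before the reference point that have zero earliness penalty
    (∀ X : CommonDueDate.Point J, CommonDueDate.IsF3Minimizer p alpha beta d X →
      ∃ C : J → ℝ, CommonDueDate.IsOptimal p alpha beta d C ∧
        ∀ j, ((CommonDueDate.delta X j = 1 ∧ alpha j = 0) →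
            C j ≤ d - CommonDueDate.shift X) ∧
          (¬ (CommonDueDate.delta X j = 1 ∧ alpha j = 0) →
            C j = d - CommonDueDate.shift X - CommonDueDate.early X j
              + CommonDueDate.tardy X j)) := by
  exact ⟨fun hyp _ hC hopt => hC.exists_isF3Minimizer hp halpha hbeta hd hyp hopt,
    fun hpos _ hX => hX.exists_encodes hp hpos hbeta hd,
    fun _ hX => hX.exists_isOptimal hp halpha hbeta hd⟩
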